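/- **Setting.** Let $M$ be a smooth $n$-manifold, possibly noncompact and possibly with boundary, with a Finsler structure $F:TM\to\mathbb R$: $F$ is continuous, smooth off the zero section, $F(x,\lambda y)=\lambda F(x,y)$ for $\lambda>0$, and $g_{ij}(x,y)=\tfrac12\,\partial^2F^2/\partial y^i\partial y^j$ is positive definite for $y\neq0$. In induced coordinates $(x^i,y^i)$ on $TM\setminus0$ let $g^{ij}$ be the inverse of $g_{ij}$ and put (summation over repeated indices) $$2G^i=\tfrac12 g^{ih}\Big(\tfrac{\partial^2F^2}{\partial y^h\partial x^k}y^k-\tfrac{\partial F^2}{\partial x^h}\Big),\quad G^i_j=\tfrac{\partial G^i}{\partial y^j},\quad \delta_i=\tfrac{\partial}{\partial x^i}-G^j_i\tfrac{\partial}{\partial y^j},$$ $$\Gamma^i_{jk}=\tfrac12g^{ih}(\delta_kg_{hj}+\delta_jg_{hk}-\delta_hg_{jk}),\qquad P_i=\tfrac{\partial G^j_i}{\partial y^j}-\Gamma^j_{ij}.$$ Let $(\tilde M,\tilde g)$ be a smooth Riemannian manifold without boundary, with Levi-Civita connection coefficients $\tilde\Gamma^\alpha_{\beta\gamma}$ and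 curvature $\tilde R(X,Y)Z=\tilde\nabla_X\tilde\nabla_YZ-\tilde\nabla_Y\tilde\nabla_XZ-\tilde\nabla_{[X,Y]}Z$. Let $\phi:M\to\tilde M$ be smooth, $\phi_i=(\partial\phi^\alpha/\partial x^i)_\alpha$. For a field $Z=(Z^\alpha(x,y))$ of vectors $Z(x,y)\in T_{\phi(x)}\tilde M$, $y\ne0$, put $$(D_iZ)^\alpha=\delta_iZ^\alpha+\tilde\Gamma^\alpha_{\beta\gamma}(\phi)\,\phi^\beta_i Z^\gamma,\qquad \Delta^{d\phi}Z=g^{ij}\big(-D_iD_jZ+\Gamma^k_{ij}D_kZ+P_iD_jZ\big).$$ The tension and the bitension of $\phi$ are the fields on $TM\setminus0$ $$\tau(\phi)=g^{ij}\big(D_i\phi_j-\Gamma^k_{ij}\phi_k-P_i\phi_j\big),\qquad \tau_2(\phi)=-\Delta^{d\phi}\tau(\phi)-g^{ij}\tilde R(\phi_i,\tau(\phi))\phi_j .$$ These do not depend on the choice of coordinates. The map $\phi$ is *harmonic* if $\tau(\phi)=0$ on $TM\setminus0$, and *biharmonic* if it satisfies the biharmonic equation $\tau_2(\phi)=0$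 on $TM\setminus0$. **Theorem.** Suppose that $(\tilde M,\tilde g)$ has strictly negative sectional curvature, that $\phi:M\to\tilde M$ is biharmonic, that the function $\|\tau(\phi)\|=\tilde g(\tau(\phi),\tau(\phi))^{1/2}$ is constant on $TM\setminus0$, and that there is a point $x_0\in M$ at which $d\phi$ has rank at least $2$. Then $\phi$ is harmonic. -/

import Mathlib

open scoped Manifold ContDiff Topology

noncomputable section

namespace FinslerRiemann

/-- The model space `ℝⁿ`. -/
abbrev Coord (n : ℕ) : Type := EuclideanSpace ℝ (Fin n)

/-- The `i`-th vector of the standard basis of `ℝⁿ`. -/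
def stdVec {n : ℕ} (i : Fin n) : Coord n := EuclideanSpace.single i 1

/-! ## Finsler structures -/

section Finsler

variable {n : ℕ} {H : Type*} [TopologicalSpace H] (I : ModelWithCorners ℝ (Coord n) H)
  (M : Type*) [TopologicalSpace M] [ChartedSpace H M] [IsManifold I ∞ M]

/-- A Finsler structure on the manifold `M` (which may have a boundary, according to `I`):
a function `F` on `TM`, continuous, smooth away from the zero section, positively homogeneous of
degree one in the fibres, whose metric tensor
`g_v(w, w) = ½ d²/dt² F²(v + t w) |_{t = 0}` is positive definite for every `v ≠ 0`. -/
structure FinslerStructure where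
  /-- The Finsler function on the tangent bundle. -/
  toFun : TangentBundle I M → ℝ
  continuous_toFun : Continuous toFun
  smooth_toFun : ContMDiffOn I.tangent 𝓘(ℝ, ℝ) ∞ toFun {v | v.2 ≠ 0}
  homogeneous : ∀ (p : M) (v : TangentSpace I p) (c : ℝ), 0 < c →
    toFun ⟨p, c • v⟩ = c * toFun ⟨p, v⟩
  posDef : ∀ (p : M) (v w : TangentSpace I p), v ≠ 0 → w ≠ 0 →
    0 < (1 / 2 : ℝ) * iteratedDeriv 2 (fun t : ℝ => toFun ⟨p, v + t • w⟩ ^ 2) 0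

variable {I M}

/-- The function `F²(x, y)` in the induced coordinates of `TM` given by the chart `e` of `M`:
`y ∈ ℝⁿ` stands for the tangent vector `yⁱ ∂ᵢ` at the point with coordinates `x`. -/
def FinslerStructure.sqCoord (F : FinslerStructure I M) (e : OpenPartialHomeomorph M H)
    (x y : Coord n) : ℝ :=
  F.toFun ⟨(e.extend I).symm x,
    mfderivWithin 𝓘(ℝ, Coord n) I (e.extend I).symm (Set.range I) x y⟩ ^ 2

end Finsler

/-! ## The geometry of the domain in local coordinates

Throughout, `s : Set (Coord n)` is the range of the model with corners of the domain (all of `ℝⁿ`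
if there is no boundary), and `L x y` is `F²` in local coordinates `(xⁱ, yⁱ)`. -/

section Domain

variable {n : ℕ} (s : Set (Coord n))

/-- `∂f/∂xⁱ` for a function `f(x, y)`. -/
def partialX (i : Fin n) (f : Coord n → Coord n → ℝ) (x y : Coord n) : ℝ :=
  fderivWithin ℝ (fun x' => f x' y) s x (stdVec i)

/-- `∂f/∂yⁱ` for a function `f(x, y)`. -/
def partialY (i : Fin n) (f : Coord n → Coord n → ℝ) (x y : Coord n) : ℝ :=
  fderiv ℝ (fun y' => f x y') y (stdVec i)

variable (L : Coord n → Coord n → ℝ)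

/-- The Finslerian metric tensor `g_{ij} = ½ (F²)_{·i·j}`. -/
def metric (i j : Fin n) (x y : Coord n) : ℝ :=
  (1 / 2) * partialY i (partialY j L) x y

/-- The inverse `g^{ij}` of the metric tensor. -/
def metricInv (i j : Fin n) (x y : Coord n) : ℝ :=
  (Matrix.of fun k l => metric L k l x y)⁻¹ i j

/-- The spray coefficients `Gⁱ`, where
`2 Gⁱ = ½ g^{ih} ((F²)_{·h,k} yᵏ - (F²)_{,h})`. -/
def spray (i : Fin n) (x y : Coord n) : ℝ :=
  (1 / 4) * ∑ h, metricInv L i h x y *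
    ((∑ k, partialX s k (partialY h L) x y * y k) - partialX s h L x y)

/-- The coefficients `Gⁱ_j = Gⁱ_{·j}` of the Cartan nonlinear connection. -/
def nonlinConn (i j : Fin n) : Coord n → Coord n → ℝ :=
  partialY j (spray s L i)

/-- The horizontal vector field `δᵢ = ∂/∂xⁱ - Gʲ_i ∂/∂yʲ` acting on functions. -/
def delta (i : Fin n) (f : Coord n → Coord n → ℝ) (x y : Coord n) : ℝ :=
  partialX s i f x y - ∑ j, nonlinConn s L j i x y * partialY j f x y

/-- The coefficients `Γⁱ_{jk} = ½ g^{ih} (δ_k g_{hj} + δ_j g_{hk} - δ_h g_{jk})` of the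
Chern-Rund connection, `D_{δ_k} δ_j = Γⁱ_{jk} δᵢ`. -/
def chern (i j k : Fin n) (x y : Coord n) : ℝ :=
  (1 / 2) * ∑ h, metricInv L i h x y *
    (delta s L k (metric L h j) x y + delta s L j (metric L h k) x y
      - delta s L h (metric L j k) x y)

/-- The torsion components `Pⁱ_{jk} = Gⁱ_{·j·k} - Γⁱ_{jk}`. -/
def torsionP (i j k : Fin n) (x y : Coord n) : ℝ :=
  partialY k (nonlinConn s L i j) x y - chern s L i j k x y

/-- The components `Pᵢ = Pʲ_{ij}` of the horizontal one-form `P`. -/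
def oneFormP (i : Fin n) (x y : Coord n) : ℝ :=
  ∑ j, torsionP s L j i j x y

end Domain

/-! ## The geometry of the codomain in local coordinates

`γ α β x` are the components of the Riemannian metric of the codomain in local coordinates. -/

section Codomain

variable {m : ℕ} (γ : Fin m → Fin m → Coord m → ℝ)

/-- `∂f/∂x^α` for a function of the codomain coordinates. -/
def partialD (α : Fin m) (f : Coord m → ℝ) (x : Coord m) : ℝ :=
  fderiv ℝ f x (stdVec α)

/-- The inverse of the Riemannian metric. -/
def riemInv (α β : Fin m) (x : Coord m) : ℝ :=
  (Matrix.of fun κ ν => γ κ ν x)⁻¹ α β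

/-- The Christoffel symbols `Γ^α_{βκ}` of the Levi-Civita connection. -/
def christoffel (α β κ : Fin m) (x : Coord m) : ℝ :=
  (1 / 2) * ∑ ν, riemInv γ α ν x *
    (partialD κ (γ ν β) x + partialD β (γ ν κ) x - partialD ν (γ β κ) x)

/-- The components `(R(∂_κ, ∂_ν) ∂_β)^α` of the curvature tensor
`R(X, Y) Z = ∇_X ∇_Y Z - ∇_Y ∇_X Z - ∇_{[X, Y]} Z`. -/
def curvatureCoeff (α β κ ν : Fin m) (x : Coord m) : ℝ :=
  partialD κ (christoffel γ α ν β) x - partialD ν (christoffel γ α κ β) x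
    + ∑ ε, (christoffel γ α κ ε x * christoffel γ ε ν β x
      - christoffel γ α ν ε x * christoffel γ ε κ β x)

/-- The curvature `(R(X, Y) Z)^α`. -/
def curvature (x : Coord m) (X Y Z : Fin m → ℝ) (α : Fin m) : ℝ :=
  ∑ β, ∑ κ, ∑ ν, curvatureCoeff γ α β κ ν x * X κ * Y ν * Z β

/-- The scalar product `⟨X, Y⟩` of tangent vectors of the codomain. -/
def scalar (x : Coord m) (X Y : Fin m → ℝ) : ℝ :=
  ∑ α, ∑ β, γ α β x * X α * Y β

/-- The sectional curvature of the plane spanned by `X` and `Y`. -/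
def sectional (x : Coord m) (X Y : Fin m → ℝ) : ℝ :=
  scalar γ x (curvature γ x X Y Y) X /
    (scalar γ x X X * scalar γ x Y Y - scalar γ x X Y ^ 2)

end Codomain

/-! ## Tension and bitension in local coordinates

`f x` is a map in local coordinates, and a section `Z = Z^α(x, y)` of the pullback of the
horizontal bundle of the codomain is represented by its components. -/

section Maps

variable {n m : ℕ} (s : Set (Coord n)) (L : Coord n → Coord n → ℝ)
  (γ : Fin m → Fin m → Coord m → ℝ) (f : Coord n → Coord m)

/-- `f^α_{,i} = ∂f^α/∂xⁱ`, regarded as a function of `(x, y)`; these are the components of the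
horizontal lift of `df(δᵢ)`. -/
def dMap (i : Fin n) (α : Fin m) : Coord n → Coord n → ℝ :=
  partialX s i (fun x _ => f x α)

/-- The components of `D_{δᵢ} Z` for the pullback connection `D = D^{df}`. -/
def covDeriv (i : Fin n) (Z : Fin m → Coord n → Coord n → ℝ) (α : Fin m) (x y : Coord n) : ℝ :=
  delta s L i (Z α) x y
    + ∑ β, ∑ κ, christoffel γ α β κ (f x) * dMap s f i β x y * Z κ x y

/-- The tension `τ = g^{ij} (D_{δᵢ} df(δⱼ) - df(D_{δᵢ} δⱼ) - Pᵢ df(δⱼ))`. -/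
def tension (α : Fin m) (x y : Coord n) : ℝ :=
  ∑ i, ∑ j, metricInv L i j x y *
    (covDeriv s L γ f i (dMap s f j) α x y
      - (∑ k, chern s L k j i x y * dMap s f k α x y)
      - oneFormP s L i x y * dMap s f j α x y)

/-- The rough Laplacian
`Δ Z = g^{ij} (- D_{δᵢ} D_{δⱼ} Z + D_{D_{δᵢ} δⱼ} Z + Pᵢ D_{δⱼ} Z)`. -/
def roughLaplacian (Z : Fin m → Coord n → Coord n → ℝ) (α : Fin m) (x y : Coord n) : ℝ :=
  ∑ i, ∑ j, metricInv L i j x y *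
    (-covDeriv s L γ f i (covDeriv s L γ f j Z) α x y
      + (∑ k, chern s L k j i x y * covDeriv s L γ f k Z α x y)
      + oneFormP s L i x y * covDeriv s L γ f j Z α x y)

/-- The bitension `τ₂ = - Δ τ - g^{ij} R(df(δᵢ), τ) df(δⱼ)`. -/
def bitension (α : Fin m) (x y : Coord n) : ℝ :=
  -roughLaplacian s L γ f (tension s L γ f) α x y
    - ∑ i, ∑ j, metricInv L i j x y *
        curvature γ (f x) (fun β => dMap s f i β x y) (fun β => tension s L γ f β x y)
          (fun β => dMap s f j β x y) α

/-- The norm `‖τ‖ = ⟨τ, τ⟩^{1/2}`. -/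
def tensionNorm (x y : Coord n) : ℝ :=
  Real.sqrt (scalar γ (f x) (fun α => tension s L γ f α x y) (fun α => tension s L γ f α x y))

end Maps

/-! ## Notions on manifolds

All quantities above are components of tensorial objects; conditions on them are imposed in all
smooth local coordinates of the manifolds. -/

section Global

variable {n m : ℕ} {H : Type*} [TopologicalSpace H] {I : ModelWithCorners ℝ (Coord n) H}
  {M : Type*} [TopologicalSpace M] [ChartedSpace H M] [IsManifold I ∞ M]
  {N : Type*} [TopologicalSpace N] [ChartedSpace (Coord m) N] [IsManifold (𝓡 m) ∞ N]

/-- A smooth Riemannian metric on the (boundaryless) manifold `N`. -/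
abbrev RiemannianMetricOn (m : ℕ) (N : Type*) [TopologicalSpace N] [ChartedSpace (Coord m) N]
    [IsManifold (𝓡 m) ∞ N] :=
  Bundle.ContMDiffRiemannianMetric (𝓡 m) ∞ (Coord m) (fun q : N => TangentSpace (𝓡 m) q)

/-- The components of the metric `g` in the chart `e`. -/
def riemCoord (g : RiemannianMetricOn m N) (e : OpenPartialHomeomorph N (Coord m))
    (α β : Fin m) (x : Coord m) : ℝ :=
  g.inner (e.symm x) (mfderiv 𝓘(ℝ, Coord m) (𝓡 m) e.symm x (stdVec α))
    (mfderiv 𝓘(ℝ, Coord m) (𝓡 m) e.symm x (stdVec β))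

/-- All sectional curvatures of `(N, g)` are strictly negative. -/
def NegativeSectionalCurvature (g : RiemannianMetricOn m N) : Prop :=
  ∀ e ∈ IsManifold.maximalAtlas (𝓡 m) ∞ N, ∀ x ∈ e.target, ∀ X Y : Fin m → ℝ,
    LinearIndependent ℝ ![X, Y] → sectional (riemCoord g e) x X Y < 0

variable (I) in
/-- The map `φ` in the charts `e` of `M` and `e'` of `N`. -/
def mapCoord (φ : M → N) (e : OpenPartialHomeomorph M H)
    (e' : OpenPartialHomeomorph N (Coord m)) (x : Coord n) : Coord m :=
  e' (φ ((e.extend I).symm x))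

variable (I) in
/-- The set of coordinates on which `mapCoord I φ e e'` represents `φ`. -/
def mapDomain (φ : M → N) (e : OpenPartialHomeomorph M H)
    (e' : OpenPartialHomeomorph N (Coord m)) : Set (Coord n) :=
  {x | x ∈ (e.extend I).target ∧ φ ((e.extend I).symm x) ∈ e'.source}

/-- `φ : (M, F) → (N, g)` is harmonic: its tension vanishes identically on `TM ∖ 0`. -/
def IsHarmonic (F : FinslerStructure I M) (g : RiemannianMetricOn m N) (φ : M → N) : Prop :=
  ∀ e ∈ IsManifold.maximalAtlas I ∞ M, ∀ e' ∈ IsManifold.maximalAtlas (𝓡 m) ∞ N,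
    ∀ x ∈ mapDomain I φ e e', ∀ y : Coord n, y ≠ 0 → ∀ α : Fin m,
      tension (Set.range I) (F.sqCoord e) (riemCoord g e') (mapCoord I φ e e') α x y = 0

/-- `φ : (M, F) → (N, g)` is biharmonic: it satisfies the biharmonic equation `τ₂(φ) = 0`
on `TM ∖ 0`. -/
def IsBiharmonic (F : FinslerStructure I M) (g : RiemannianMetricOn m N) (φ : M → N) : Prop :=
  ∀ e ∈ IsManifold.maximalAtlas I ∞ M, ∀ e' ∈ IsManifold.maximalAtlas (𝓡 m) ∞ N,
    ∀ x ∈ mapDomain I φ e e', ∀ y : Coord n, y ≠ 0 → ∀ α : Fin m,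
      bitension (Set.range I) (F.sqCoord e) (riemCoord g e') (mapCoord I φ e e') α x y = 0

/-- The function `‖τ(φ)‖` on `TM ∖ 0` is constant. -/
def HasConstantTensionNorm (F : FinslerStructure I M) (g : RiemannianMetricOn m N)
    (φ : M → N) : Prop :=
  ∃ c : ℝ, ∀ e ∈ IsManifold.maximalAtlas I ∞ M, ∀ e' ∈ IsManifold.maximalAtlas (𝓡 m) ∞ N,
    ∀ x ∈ mapDomain I φ e e', ∀ y : Coord n, y ≠ 0 →
      tensionNorm (Set.range I) (F.sqCoord e) (riemCoord g e') (mapCoord I φ e e') x y = c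

variable (I) (m) in
/-- The rank of `φ` at the point `p`, that is, the rank of its differential. -/
def rankAt (φ : M → N) (p : M) : ℕ :=
  Module.finrank ℝ (LinearMap.range (mfderiv I (𝓡 m) φ p).toLinearMap)

end Global

end FinslerRiemann

end

/-!
The theorem is a Bochner argument. Let `τ` be the tension of the biharmonic map `φ`, of constant
norm `c`. If `c = 0`, positivity of the metric of the target gives `τ = 0`. Suppose `c ≠ 0`.

The pullback connection `D` is metric (`IsLocalMap.delta_scalar`): the horizontal derivative `δᵢ`
is a derivation, being a directional derivative on `TM ∖ 0` (`IsFinslerSq.delta_eq`), and the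
Christoffel symbols of the target are compatible with its metric (`IsRiemMetric.derivMat_gram`).
Differentiating `⟨τ, τ⟩ = c²` once and twice gives `⟨Dⱼτ, τ⟩ = 0` and
`⟨DᵢDⱼτ, τ⟩ = -⟨Dᵢτ, Dⱼτ⟩`. Hence all first-order terms of the rough Laplacian drop out and
`⟨Δτ, τ⟩ = g^{ij}⟨Dᵢτ, Dⱼτ⟩ ≥ 0` (`IsLocalMap.scalar_roughLaplacian`). Pairing the biharmonic
equation with `τ`, and using that `R(X, Y)` is skew-adjoint, one finds
`0 = -g^{ij}⟨Dᵢτ, Dⱼτ⟩ + g^{ij}⟨R(φᵢ, τ)τ, φⱼ⟩`.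
Since the curvature is negative, the form `X ↦ ⟨R(X, τ)τ, X⟩` is nonpositive and vanishes only on
the multiples of `τ` (`IsRiemMetric.scalar_curvature_neg`). Diagonalizing `g^{ij}`, both vanish
and every `φᵢ` is a multiple of `τ` (`IsLocalMap.dMap_mem_span_tension`), so that `dφ` has rank at
most one everywhere, against the hypothesis.

The computation takes place in charts. Points of the boundary need no separate treatment: partial
derivatives in `x` are taken within the range of the model with corners, which has unique
derivatives, and all coefficients are smooth functions on `D × (ℝⁿ ∖ {0})` for a relatively
open subset `D` of that range.
-/

namespace FinslerRiemann

/-! ### Smooth functions on the slit tangent bundle of a coordinate domain -/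

section MatrixInverse

variable {E ι : Type*} [NormedAddCommGroup E] [NormedSpace ℝ E] [Fintype ι] [DecidableEq ι]
  {W : Set E} {A : ι → ι → E → ℝ} {r : ℕ∞ω}

theorem contDiffOn_det (hA : ∀ i j, ContDiffOn ℝ r (A i j) W) :
    ContDiffOn ℝ r (fun p => (Matrix.of fun i j => A i j p).det) W := by
  simp only [Matrix.det_apply, Matrix.of_apply, Units.smul_def, zsmul_eq_mul]
  exact ContDiffOn.sum fun σ _ => contDiffOn_const.mul (contDiffOn_prod fun i _ => hA _ _)

theorem contDiffOn_matrixInv (hA : ∀ i j, ContDiffOn ℝ r (A i j) W)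
    (hdet : ∀ p ∈ W, (Matrix.of fun i j => A i j p).det ≠ 0) (i j : ι) :
    ContDiffOn ℝ r (fun p => (Matrix.of fun i j => A i j p)⁻¹ i j) W := by
  simp only [Matrix.inv_def, Matrix.smul_apply, Ring.inverse_eq_inv', Matrix.adjugate_apply,
    smul_eq_mul]
  refine ((contDiffOn_det hA).inv hdet).mul ?_
  exact contDiffOn_det (A := fun k l p =>
    (Matrix.of fun i j => A i j p).updateRow j (Pi.single i 1) k l) fun k l => by
      by_cases hk : k = j
      · subst hk; simpa using contDiffOn_const
      · simpa [Matrix.updateRow_ne hk] using hA k l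

end MatrixInverse

section Calculus

variable {n : ℕ} {s D : Set (Coord n)}

/-- `D` is relatively open in `s`, and `s` has unique derivatives. Here `s` is the range of a model
with corners, so that derivatives at boundary points are derivatives within `s`, and `D` is the
domain of a coordinate expression. -/
structure IsRelOpen (s D : Set (Coord n)) : Prop where
  uniqueDiffOn : UniqueDiffOn ℝ s
  subset : D ⊆ s
  mem_nhdsWithin : ∀ x ∈ D, D ∈ 𝓝[s] x

/-- The coordinate form of `TD ∖ 0`. -/
def slit (D : Set (Coord n)) : Set (Coord n × Coord n) := D ×ˢ {0}ᶜ

/-- The function `h(x, y)` is smooth on `TD ∖ 0`. -/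
def SmoothOn (D : Set (Coord n)) (h : Coord n → Coord n → ℝ) : Prop :=
  ContDiffOn ℝ ∞ (fun p : Coord n × Coord n => h p.1 p.2) (slit D)

theorem mk_mem_slit {x y : Coord n} (hx : x ∈ D) (hy : y ≠ 0) : (x, y) ∈ slit D := ⟨hx, hy⟩

theorem IsRelOpen.nhdsWithin_eq (hD : IsRelOpen s D) {x : Coord n} (hx : x ∈ D) :
    𝓝[D] x = 𝓝[s] x :=
  le_antisymm (nhdsWithin_mono _ hD.subset) (nhdsWithin_le_of_mem (hD.mem_nhdsWithin x hx))

theorem IsRelOpen.uniqueDiffOn_self (hD : IsRelOpen s D) : UniqueDiffOn ℝ D := fun x hx =>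
  (uniqueDiffWithinAt_congr (hD.nhdsWithin_eq hx)).2 (hD.uniqueDiffOn x (hD.subset hx))

theorem IsRelOpen.uniqueDiffOn_slit (hD : IsRelOpen s D) : UniqueDiffOn ℝ (slit D) :=
  hD.uniqueDiffOn_self.prod isOpen_compl_singleton.uniqueDiffOn

namespace SmoothOn

variable {h k : Coord n → Coord n → ℝ}

theorem differentiableWithinAt (hh : SmoothOn D h) {x y : Coord n} (hx : x ∈ D) (hy : y ≠ 0) :
    DifferentiableWithinAt ℝ (fun p : Coord n × Coord n => h p.1 p.2) (slit D) (x, y) :=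
  hh.differentiableOn (by simp) _ (mk_mem_slit hx hy)

theorem add (hh : SmoothOn D h) (hk : SmoothOn D k) : SmoothOn D fun x y => h x y + k x y :=
  ContDiffOn.add hh hk

theorem sub (hh : SmoothOn D h) (hk : SmoothOn D k) : SmoothOn D fun x y => h x y - k x y :=
  ContDiffOn.sub hh hk

theorem mul (hh : SmoothOn D h) (hk : SmoothOn D k) : SmoothOn D fun x y => h x y * k x y :=
  ContDiffOn.mul hh hk

theorem const (c : ℝ) : SmoothOn D fun _ _ => c := contDiffOn_const

theorem sum {ι : Type*} {t : Finset ι} {h : ι → Coord n → Coord n → ℝ}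
    (hh : ∀ i, SmoothOn D (h i)) : SmoothOn D fun x y => ∑ i ∈ t, h i x y :=
  ContDiffOn.sum fun i _ => hh i

theorem coord (k : Fin n) : SmoothOn D fun _ y => y k := by
  unfold SmoothOn
  fun_prop

theorem comp_fst {h : Coord n → ℝ} (hh : ContDiffOn ℝ ∞ h D) : SmoothOn D fun x _ => h x :=
  hh.comp contDiffOn_fst fun _ hp => hp.1

theorem matrixInv {ι : Type*} [Fintype ι] [DecidableEq ι] {A : ι → ι → Coord n → Coord n → ℝ}
    (hA : ∀ i j, SmoothOn D (A i j))
    (hdet : ∀ x ∈ D, ∀ y ≠ 0, (Matrix.of fun i j => A i j x y).det ≠ 0) (i j : ι) :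
    SmoothOn D fun x y => (Matrix.of fun i j => A i j x y)⁻¹ i j :=
  contDiffOn_matrixInv (A := fun i j (p : Coord n × Coord n) => A i j p.1 p.2) hA
    (fun _ hp => hdet _ hp.1 _ hp.2) i j

end SmoothOn

variable {h k : Coord n → Coord n → ℝ} {x y : Coord n}

/-- Since `D` is relatively open in `s`, the derivative within `s` in the variable `x` may be
computed within `D`. -/
theorem hasFDerivWithinAt_fst (hD : IsRelOpen s D) (hh : SmoothOn D h) (hx : x ∈ D)
    (hy : y ≠ 0) :
    HasFDerivWithinAt (fun x' => h x' y)
      ((fderivWithin ℝ (fun p : Coord n × Coord n => h p.1 p.2) (slit D) (x, y)).comp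
        (ContinuousLinearMap.inl ℝ _ _)) s x := by
  have h1 : HasFDerivWithinAt (fun x' : Coord n => (x', y)) (ContinuousLinearMap.inl ℝ _ _) D x :=
    (hasFDerivAt_prodMk_left x y).hasFDerivWithinAt
  have h2 := (hh.differentiableWithinAt hx hy).hasFDerivWithinAt.comp x h1
    (fun x' hx' => mk_mem_slit hx' hy)
  exact h2.mono_of_mem_nhdsWithin (hD.mem_nhdsWithin x hx)

theorem hasFDerivAt_snd (hh : SmoothOn D h) (hx : x ∈ D) (hy : y ≠ 0) :
    HasFDerivAt (fun y' => h x y')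
      ((fderivWithin ℝ (fun p : Coord n × Coord n => h p.1 p.2) (slit D) (x, y)).comp
        (ContinuousLinearMap.inr ℝ _ _)) y := by
  have h1 : HasFDerivWithinAt (fun y' : Coord n => (x, y'))
      (ContinuousLinearMap.inr ℝ _ _) {0}ᶜ y :=
    (hasFDerivAt_prodMk_right x y).hasFDerivWithinAt
  have h2 := (hh.differentiableWithinAt hx hy).hasFDerivWithinAt.comp y h1
    (fun y' hy' => mk_mem_slit hx hy')
  exact h2.hasFDerivAt (isOpen_compl_singleton.mem_nhds hy)

theorem partialX_eq (hD : IsRelOpen s D) (hh : SmoothOn D h) (hx : x ∈ D) (hy : y ≠ 0)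
    (i : Fin n) : partialX s i h x y =
      fderivWithin ℝ (fun p : Coord n × Coord n => h p.1 p.2) (slit D) (x, y) (stdVec i, 0) := by
  rw [partialX, (hasFDerivWithinAt_fst hD hh hx hy).fderivWithin
    (hD.uniqueDiffOn x (hD.subset hx))]
  simp

theorem partialY_eq (hh : SmoothOn D h) (hx : x ∈ D) (hy : y ≠ 0)
    (i : Fin n) : partialY i h x y =
      fderivWithin ℝ (fun p : Coord n × Coord n => h p.1 p.2) (slit D) (x, y) (0, stdVec i) := by
  rw [partialY, (hasFDerivAt_snd hh hx hy).fderiv]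
  simp

theorem SmoothOn.partialX (hD : IsRelOpen s D) (hh : SmoothOn D h) (i : Fin n) :
    SmoothOn D (partialX s i h) := by
  have h1 := (ContDiffOn.fderivWithin (m := ∞) hh hD.uniqueDiffOn_slit (by simp)).clm_apply
    (contDiffOn_const (c := ((stdVec i, 0) : Coord n × Coord n)))
  exact h1.congr fun p hp => partialX_eq hD hh hp.1 hp.2 i

theorem SmoothOn.partialY (hD : IsRelOpen s D) (hh : SmoothOn D h) (i : Fin n) :
    SmoothOn D (partialY i h) := by
  have h1 := (ContDiffOn.fderivWithin (m := ∞) hh hD.uniqueDiffOn_slit (by simp)).clm_apply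
    (contDiffOn_const (c := ((0, stdVec i) : Coord n × Coord n)))
  exact h1.congr fun p hp => partialY_eq hh hp.1 hp.2 i

/-! ### Smoothness of the Finslerian objects -/

variable {L : Coord n → Coord n → ℝ}

/-- `L` is the square of a Finsler function on `TD ∖ 0`: it is smooth there and its metric
tensor is positive definite. -/
structure IsFinslerSq (s D : Set (Coord n)) (L : Coord n → Coord n → ℝ) : Prop where
  isRelOpen : IsRelOpen s D
  smoothOn : SmoothOn D L
  posDef : ∀ x ∈ D, ∀ y ≠ 0, (Matrix.of fun k l => metric L k l x y).PosDef

namespace IsFinslerSq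

theorem smoothOn_metric (hL : IsFinslerSq s D L) (i j : Fin n) : SmoothOn D (metric L i j) :=
  (SmoothOn.const _).mul ((hL.smoothOn.partialY hL.isRelOpen j).partialY hL.isRelOpen i)

theorem smoothOn_metricInv (hL : IsFinslerSq s D L) (i j : Fin n) :
    SmoothOn D (metricInv L i j) :=
  SmoothOn.matrixInv hL.smoothOn_metric (fun x hx y hy => (hL.posDef x hx y hy).det_pos.ne') i j

theorem smoothOn_spray (hL : IsFinslerSq s D L) (i : Fin n) : SmoothOn D (spray s L i) :=
  (SmoothOn.const _).mul (SmoothOn.sum fun h => (hL.smoothOn_metricInv i h).mul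
    ((SmoothOn.sum fun k => ((hL.smoothOn.partialY hL.isRelOpen h).partialX hL.isRelOpen k).mul
      (SmoothOn.coord k)).sub (hL.smoothOn.partialX hL.isRelOpen h)))

theorem smoothOn_nonlinConn (hL : IsFinslerSq s D L) (i j : Fin n) :
    SmoothOn D (nonlinConn s L i j) :=
  (hL.smoothOn_spray i).partialY hL.isRelOpen j

theorem smoothOn_delta (hL : IsFinslerSq s D L) (hh : SmoothOn D h) (i : Fin n) :
    SmoothOn D (delta s L i h) :=
  (hh.partialX hL.isRelOpen i).sub
    (SmoothOn.sum fun j => (hL.smoothOn_nonlinConn j i).mul (hh.partialY hL.isRelOpen j))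

theorem smoothOn_chern (hL : IsFinslerSq s D L) (i j k : Fin n) : SmoothOn D (chern s L i j k) :=
  (SmoothOn.const _).mul (SmoothOn.sum fun h => (hL.smoothOn_metricInv i h).mul
    (((hL.smoothOn_delta (hL.smoothOn_metric h j) k).add
      (hL.smoothOn_delta (hL.smoothOn_metric h k) j)).sub
        (hL.smoothOn_delta (hL.smoothOn_metric j k) h)))

theorem smoothOn_oneFormP (hL : IsFinslerSq s D L) (i : Fin n) : SmoothOn D (oneFormP s L i) :=
  SmoothOn.sum fun j => ((hL.smoothOn_nonlinConn j i).partialY hL.isRelOpen j).sub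
    (hL.smoothOn_chern j i j)

/-! ### The horizontal derivatives as directional derivatives -/

/-- `δᵢ` is the derivative in the direction `(eᵢ, -Gʲ_i eⱼ)`. -/
theorem delta_eq (hL : IsFinslerSq s D L) (hh : SmoothOn D h) (hx : x ∈ D) (hy : y ≠ 0)
    (i : Fin n) : delta s L i h x y =
      fderivWithin ℝ (fun p : Coord n × Coord n => h p.1 p.2) (slit D) (x, y)
        (stdVec i, -∑ j, nonlinConn s L j i x y • stdVec j) := by
  have h1 : ((stdVec i, -∑ j, nonlinConn s L j i x y • stdVec j) : Coord n × Coord n)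
      = (stdVec i, 0) - ∑ j, nonlinConn s L j i x y • ((0, stdVec j) : Coord n × Coord n) := by
    ext1
    · simp [Prod.fst_sum]
    · simp [Prod.snd_sum]
  rw [delta, partialX_eq hL.isRelOpen hh hx hy, h1, map_sub, map_sum]
  simp only [map_smul, smul_eq_mul, partialY_eq hh hx hy]

theorem delta_congr (hL : IsFinslerSq s D L) (hh : SmoothOn D h) (hk : SmoothOn D k)
    (hhk : ∀ x ∈ D, ∀ y ≠ 0, h x y = k x y) (hx : x ∈ D) (hy : y ≠ 0) (i : Fin n) :
    delta s L i h x y = delta s L i k x y := by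
  rw [hL.delta_eq hh hx hy, hL.delta_eq hk hx hy]
  congr 1
  exact fderivWithin_congr (fun p hp => hhk _ hp.1 _ hp.2) (hhk _ hx _ hy)

theorem delta_const (c : ℝ) (i : Fin n) : delta s L i (fun _ _ => c) x y = 0 := by
  simp [delta, FinslerRiemann.partialX, FinslerRiemann.partialY]

theorem delta_mul (hL : IsFinslerSq s D L) (hh : SmoothOn D h) (hk : SmoothOn D k)
    (hx : x ∈ D) (hy : y ≠ 0) (i : Fin n) :
    delta s L i (fun x y => h x y * k x y) x y =
      delta s L i h x y * k x y + h x y * delta s L i k x y := by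
  rw [hL.delta_eq hh hx hy, hL.delta_eq hk hx hy, hL.delta_eq (hh.mul hk) hx hy,
    fderivWithin_fun_mul (hL.isRelOpen.uniqueDiffOn_slit _ (mk_mem_slit hx hy))
      (hh.differentiableWithinAt hx hy) (hk.differentiableWithinAt hx hy)]
  simp only [add_apply, smul_apply, smul_eq_mul]
  ring

theorem delta_sum (hL : IsFinslerSq s D L) {ι : Type*} {t : Finset ι}
    {h : ι → Coord n → Coord n → ℝ} (hh : ∀ i, SmoothOn D (h i))
    (hx : x ∈ D) (hy : y ≠ 0) (i : Fin n) :
    delta s L i (fun x y => ∑ a ∈ t, h a x y) x y = ∑ a ∈ t, delta s L i (h a) x y := by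
  rw [hL.delta_eq (SmoothOn.sum hh) hx hy,
    fderivWithin_fun_sum (hL.isRelOpen.uniqueDiffOn_slit _ (mk_mem_slit hx hy))
      fun a _ => (hh a).differentiableWithinAt hx hy]
  simp only [sum_apply, hL.delta_eq (hh _) hx hy]

end IsFinslerSq
end Calculus
/-! ### The Levi-Civita connection in coordinates -/

section Riemannian

variable {m : ℕ} {T : Set (Coord m)} {γ : Fin m → Fin m → Coord m → ℝ} {x : Coord m}

/-- `γ` is a smooth Riemannian metric on the open set `T` of `ℝᵐ`. -/
structure IsRiemMetric (T : Set (Coord m)) (γ : Fin m → Fin m → Coord m → ℝ) : Prop where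
  isOpen : IsOpen T
  contDiffOn : ∀ α β, ContDiffOn ℝ ∞ (γ α β) T
  symm : ∀ α β, γ α β = γ β α
  posDef : ∀ x ∈ T, (Matrix.of fun α β => γ α β x).PosDef

/-- The Gram matrix `(γ_{αβ})`. -/
noncomputable def gram (γ : Fin m → Fin m → Coord m → ℝ) (x : Coord m) : Matrix (Fin m) (Fin m) ℝ :=
  Matrix.of fun α β => γ α β x

/-- The connection matrix `(Γ^α_{κβ})_{αβ}` of the derivation `∇_κ`. -/
noncomputable def connMat (γ : Fin m → Fin m → Coord m → ℝ) (κ : Fin m) (x : Coord m) :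
    Matrix (Fin m) (Fin m) ℝ :=
  Matrix.of fun α β => christoffel γ α κ β x

/-- The entrywise derivative `∂B/∂x^ν` of a matrix-valued function. -/
noncomputable def derivMat (ν : Fin m) (B : Coord m → Matrix (Fin m) (Fin m) ℝ) (x : Coord m) :
    Matrix (Fin m) (Fin m) ℝ :=
  Matrix.of fun α β => partialD ν (fun x => B x α β) x

theorem scalar_eq_dotProduct (X Y : Fin m → ℝ) :
    scalar γ x X Y = X ⬝ᵥ (gram γ x).mulVec Y := by
  simp only [scalar, dotProduct, Matrix.mulVec, gram, Matrix.of_apply, Finset.mul_sum]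
  exact Finset.sum_congr rfl fun α _ => Finset.sum_congr rfl fun β _ => by ring

theorem derivMat_mul {ν : Fin m} {B C : Coord m → Matrix (Fin m) (Fin m) ℝ}
    (hB : ∀ α β, DifferentiableAt ℝ (fun x => B x α β) x)
    (hC : ∀ α β, DifferentiableAt ℝ (fun x => C x α β) x) :
    derivMat ν (fun x => B x * C x) x = derivMat ν B x * C x + B x * derivMat ν C x := by
  ext α β
  simp only [derivMat, Matrix.of_apply, Matrix.add_apply, Matrix.mul_apply, partialD]
  rw [fderiv_fun_sum (A := fun ε x => B x α ε * C x ε β) fun ε _ => (hB α ε).fun_mul (hC ε β),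
    sum_apply, ← Finset.sum_add_distrib]
  refine Finset.sum_congr rfl fun ε _ => ?_
  rw [fderiv_fun_mul (hB α ε) (hC ε β)]
  simp only [add_apply, smul_apply, smul_eq_mul]
  ring

theorem derivMat_add {ν : Fin m} {B C : Coord m → Matrix (Fin m) (Fin m) ℝ}
    (hB : ∀ α β, DifferentiableAt ℝ (fun x => B x α β) x)
    (hC : ∀ α β, DifferentiableAt ℝ (fun x => C x α β) x) :
    derivMat ν (fun x => B x + C x) x = derivMat ν B x + derivMat ν C x := by
  ext α β
  simp only [derivMat, Matrix.of_apply, Matrix.add_apply, partialD]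
  rw [fderiv_fun_add (hB α β) (hC α β)]
  simp

theorem derivMat_transpose {ν : Fin m} {B : Coord m → Matrix (Fin m) (Fin m) ℝ} :
    derivMat ν (fun x => (B x).transpose) x = (derivMat ν B x).transpose := rfl

theorem derivMat_comm {B : Coord m → Matrix (Fin m) (Fin m) ℝ} {κ ν : Fin m}
    (hB : ∀ α β, ContDiffAt ℝ 2 (fun x => B x α β) x) :
    derivMat ν (derivMat κ B) x = derivMat κ (derivMat ν B) x := by
  ext α β
  have key : ∀ κ ν : Fin m, derivMat ν (derivMat κ B) x α β =
      fderiv ℝ (fderiv ℝ fun x => B x α β) x (stdVec ν) (stdVec κ) := fun κ ν => by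
    have h1 : DifferentiableAt ℝ (fderiv ℝ fun x => B x α β) x :=
      ((hB α β).fderiv_right (m := 1) (by norm_num)).differentiableAt (by norm_num)
    simp only [derivMat, Matrix.of_apply, partialD]
    rw [fderiv_clm_apply h1 (differentiableAt_const _)]
    simp
  rw [key, key]
  exact (hB α β).isSymmSndFDerivAt (by simp) _ _

namespace IsRiemMetric

variable (hγ : IsRiemMetric T γ)
include hγ

theorem contDiffAt (hx : x ∈ T) (α β : Fin m) : ContDiffAt ℝ ∞ (γ α β) x :=
  (hγ.contDiffOn α β).contDiffAt (hγ.isOpen.mem_nhds hx)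

theorem contDiffOn_partialD {h : Coord m → ℝ} (hh : ContDiffOn ℝ ∞ h T) (κ : Fin m) :
    ContDiffOn ℝ ∞ (partialD κ h) T :=
  (hh.fderiv_of_isOpen (m := ∞) hγ.isOpen (by simp)).clm_apply contDiffOn_const

theorem contDiffOn_christoffel (α β κ : Fin m) : ContDiffOn ℝ ∞ (christoffel γ α β κ) T := by
  have hinv : ∀ α β, ContDiffOn ℝ ∞ (riemInv γ α β) T := fun α β =>
    contDiffOn_matrixInv hγ.contDiffOn (fun x hx => (hγ.posDef x hx).det_pos.ne') α β
  refine contDiffOn_const.mul (ContDiffOn.sum fun ν _ => (hinv α ν).mul ?_)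
  exact ((hγ.contDiffOn_partialD (hγ.contDiffOn _ _) _).add
    (hγ.contDiffOn_partialD (hγ.contDiffOn _ _) _)).sub
    (hγ.contDiffOn_partialD (hγ.contDiffOn _ _) _)

theorem gram_transpose : (gram γ x).transpose = gram γ x := by
  ext α β
  simp [gram, hγ.symm α β]

theorem scalar_comm (X Y : Fin m → ℝ) : scalar γ x X Y = scalar γ x Y X := by
  rw [scalar_eq_dotProduct, scalar_eq_dotProduct, dotProduct_comm, ← Matrix.vecMul_transpose,
    hγ.gram_transpose, Matrix.dotProduct_mulVec]

/-- The Christoffel symbols with lowered first index. -/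
theorem gram_mul_connMat (hx : x ∈ T) (κ α β : Fin m) :
    (gram γ x * connMat γ κ x) α β =
      (1 / 2) * (partialD β (γ α κ) x + partialD κ (γ α β) x - partialD α (γ κ β) x) := by
  have hdet : IsUnit (gram γ x).det := (hγ.posDef x hx).det_pos.ne'.isUnit
  have h1 : ∀ ε, connMat γ κ x ε β = ((gram γ x)⁻¹.mulVec fun ν =>
      (1 / 2) * (partialD β (γ ν κ) x + partialD κ (γ ν β) x - partialD ν (γ κ β) x)) ε := by
    intro ε
    simp only [connMat, Matrix.of_apply, christoffel, Matrix.mulVec, dotProduct, Finset.mul_sum]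
    exact Finset.sum_congr rfl fun ν _ => by rw [riemInv, gram]; ring
  rw [Matrix.mul_apply]
  simp only [h1]
  change ((gram γ x).mulVec ((gram γ x)⁻¹.mulVec _)) α = _
  rw [Matrix.mulVec_mulVec, Matrix.mul_nonsing_inv _ hdet, Matrix.one_mulVec]

/-- The Christoffel symbols are compatible with the metric: `∂_κ G = G A_κ + A_κᵀ G`. -/
theorem derivMat_gram (hx : x ∈ T) (κ : Fin m) : derivMat κ (gram γ) x =
    gram γ x * connMat γ κ x + (connMat γ κ x).transpose * gram γ x := by
  have h1 : (connMat γ κ x).transpose * gram γ x = (gram γ x * connMat γ κ x).transpose := by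
    rw [Matrix.transpose_mul, hγ.gram_transpose]
  ext α β
  rw [h1, Matrix.add_apply, Matrix.transpose_apply, hγ.gram_mul_connMat hx,
    hγ.gram_mul_connMat hx, hγ.symm α κ, hγ.symm β κ, hγ.symm β α]
  simp only [derivMat, gram, Matrix.of_apply]
  ring

/-- The curvature endomorphism `R(∂_κ, ∂_ν)` is skew-adjoint. -/
theorem gram_mul_curvatureCoeff_skew (hx : x ∈ T) (κ ν : Fin m) :
    gram γ x * (Matrix.of fun α β => curvatureCoeff γ α β κ ν x) +
      (gram γ x * (Matrix.of fun α β => curvatureCoeff γ α β κ ν x)).transpose = 0 := by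
  -- in matrix form, `R_{κν} = ∂_κ A_ν - ∂_ν A_κ + [A_κ, A_ν]`
  have hR : (Matrix.of fun α β => curvatureCoeff γ α β κ ν x) =
      derivMat κ (connMat γ ν) x - derivMat ν (connMat γ κ) x
        + connMat γ κ x * connMat γ ν x - connMat γ ν x * connMat γ κ x := by
    ext α β
    simp only [Matrix.of_apply, Matrix.sub_apply, Matrix.add_apply, Matrix.mul_apply,
      curvatureCoeff, derivMat, connMat, Finset.sum_sub_distrib]
    ring
  have hG : ∀ α β, DifferentiableAt ℝ (fun x => gram γ x α β) x := fun α β =>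
    (hγ.contDiffAt hx α β).differentiableAt (by simp)
  have hA : ∀ κ α β, DifferentiableAt ℝ (fun x => connMat γ κ x α β) x := fun κ α β =>
    ((hγ.contDiffOn_christoffel α κ β).contDiffAt (hγ.isOpen.mem_nhds hx)).differentiableAt
      (by simp)
  have hAt : ∀ κ α β, DifferentiableAt ℝ (fun x => (connMat γ κ x).transpose α β) x :=
    fun κ α β => hA κ β α
  have hmul : ∀ {B C : Coord m → Matrix (Fin m) (Fin m) ℝ},
      (∀ α β, DifferentiableAt ℝ (fun x => B x α β) x) →
      (∀ α β, DifferentiableAt ℝ (fun x => C x α β) x) →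
      ∀ α β, DifferentiableAt ℝ (fun x => (B x * C x) α β) x := fun hB hC α β => by
    simp only [Matrix.mul_apply]
    exact DifferentiableAt.fun_sum fun ε _ => (hB α ε).mul (hC ε β)
  have h2 : ∀ κ ν, derivMat ν (derivMat κ (gram γ)) x =
      (derivMat ν (gram γ) x * connMat γ κ x + gram γ x * derivMat ν (connMat γ κ) x) +
      ((derivMat ν (connMat γ κ) x).transpose * gram γ x +
        (connMat γ κ x).transpose * derivMat ν (gram γ) x) := fun κ ν => by
    have h3 : derivMat ν (derivMat κ (gram γ)) x = derivMat ν (fun x =>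
        gram γ x * connMat γ κ x + (connMat γ κ x).transpose * gram γ x) x := by
      ext α β
      simp only [derivMat, Matrix.of_apply, partialD]
      congr 1
      apply Filter.EventuallyEq.fderiv_eq
      filter_upwards [hγ.isOpen.mem_nhds hx] with z hz
      rw [← hγ.derivMat_gram hz κ]
      rfl
    rw [h3, derivMat_add (hmul hG (hA κ)) (hmul (hAt κ) hG), derivMat_mul hG (hA κ),
      derivMat_mul (hAt κ) hG, derivMat_transpose]
  -- the symmetry of the second derivatives of `G`, expanded with `∂_κ G = G A_κ + A_κᵀ G`
  have hcomm := derivMat_comm (κ := κ) (ν := ν) (B := gram γ) (x := x) fun α β =>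
    (hγ.contDiffAt hx α β).of_le (ENat.LEInfty.out)
  rw [h2, h2, hγ.derivMat_gram hx, hγ.derivMat_gram hx] at hcomm
  rw [hR]
  simp only [Matrix.transpose_mul, Matrix.transpose_add, Matrix.transpose_sub,
    hγ.gram_transpose]
  rw [← sub_eq_zero] at hcomm
  rw [← neg_eq_zero, ← hcomm]
  noncomm_ring

end IsRiemMetric
end Riemannian
/-! ### Traces of bilinear forms -/

section Trace

open scoped MatrixOrder in
/-- The trace `S^{ij} B(aᵢ, aⱼ)` of a bilinear form is a sum of values `B(bₖ, bₖ)`, where the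
vectors `bₖ` generate the vectors `aᵢ`. -/
theorem exists_sum_eq_sum_diag {ι V : Type*} [Fintype ι] [DecidableEq ι] [AddCommGroup V]
    [Module ℝ V] {S : Matrix ι ι ℝ} (hS : S.PosDef) (a : ι → V) :
    ∃ b : ι → V, (∀ i, a i ∈ Submodule.span ℝ (Set.range b)) ∧
      ∀ B : V →ₗ[ℝ] V →ₗ[ℝ] ℝ, ∑ i, ∑ j, S i j * B (a i) (a j) = ∑ k, B (b k) (b k) := by
  obtain ⟨C, hC, hSC⟩ :=
    CStarAlgebra.isStrictlyPositive_iff_eq_star_mul_self.mp hS.isStrictlyPositive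
  refine ⟨fun k => ∑ i, C k i • a i, fun i => ?_, fun B => ?_⟩
  · have hinv : C⁻¹ * C = 1 := Matrix.nonsing_inv_mul _ ((Matrix.isUnit_iff_isUnit_det _).1 hC)
    have h1 : a i = ∑ k, C⁻¹ i k • ∑ j, C k j • a j := by
      simp only [Finset.smul_sum, smul_smul]
      rw [Finset.sum_comm]
      simp only [← Finset.sum_smul, ← Matrix.mul_apply, hinv, Matrix.one_apply]
      simp
    rw [h1]
    exact Submodule.sum_mem _ fun k _ =>
      Submodule.smul_mem _ _ (Submodule.subset_span (Set.mem_range_self k))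
  · have h1 : ∀ i j, S i j = ∑ k, C k i * C k j := fun i j => by
      rw [hSC, Matrix.mul_apply]
      simp [Matrix.star_apply]
    simp only [h1, map_sum, map_smul, LinearMap.sum_apply, LinearMap.smul_apply, smul_eq_mul,
      Finset.sum_mul, Finset.mul_sum]
    rw [Finset.sum_comm_cycle]
    refine Finset.sum_congr rfl fun k _ => ?_
    rw [Finset.sum_comm]
    exact Finset.sum_congr rfl fun i _ => Finset.sum_congr rfl fun j _ => by ring

theorem sum_mul_bilin_nonpos {ι V : Type*} [Fintype ι] [DecidableEq ι] [AddCommGroup V]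
    [Module ℝ V] {S : Matrix ι ι ℝ} (hS : S.PosDef) (a : ι → V) (B : V →ₗ[ℝ] V →ₗ[ℝ] ℝ)
    (hB : ∀ X, B X X ≤ 0) : ∑ i, ∑ j, S i j * B (a i) (a j) ≤ 0 := by
  obtain ⟨b, -, hb⟩ := exists_sum_eq_sum_diag hS a
  rw [hb]
  exact Finset.sum_nonpos fun k _ => hB _

/-- The equality case: if the trace of a nonpositive form vanishes, all vectors `aᵢ` lie in any
subspace that contains the null vectors of the form. -/
theorem mem_of_sum_mul_bilin_nonneg {ι V : Type*} [Fintype ι] [DecidableEq ι] [AddCommGroup V]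
    [Module ℝ V] {S : Matrix ι ι ℝ} (hS : S.PosDef) (a : ι → V) (B : V →ₗ[ℝ] V →ₗ[ℝ] ℝ)
    (hB : ∀ X, B X X ≤ 0) (U : Submodule ℝ V) (hU : ∀ X, B X X = 0 → X ∈ U)
    (h : 0 ≤ ∑ i, ∑ j, S i j * B (a i) (a j)) (i : ι) : a i ∈ U := by
  obtain ⟨b, hab, hb⟩ := exists_sum_eq_sum_diag hS a
  rw [hb] at h
  have h0 := (Finset.sum_eq_zero_iff_of_nonpos fun k _ => hB (b k)).1
    (le_antisymm (Finset.sum_nonpos fun k _ => hB _) h)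
  refine Submodule.span_le.2 ?_ (hab i)
  rintro _ ⟨k, rfl⟩
  exact hU _ (h0 k (Finset.mem_univ k))

end Trace

/-! ### The curvature tensor -/

section Curvature

variable {m : ℕ} {T : Set (Coord m)} {γ : Fin m → Fin m → Coord m → ℝ} {x : Coord m}

/-- The scalar product as a bilinear form. -/
noncomputable def scalarForm (γ : Fin m → Fin m → Coord m → ℝ) (x : Coord m) :
    (Fin m → ℝ) →ₗ[ℝ] (Fin m → ℝ) →ₗ[ℝ] ℝ :=
  Matrix.toBilin' (gram γ x)

theorem scalarForm_apply (X Y : Fin m → ℝ) : scalarForm γ x X Y = scalar γ x X Y := by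
  rw [scalarForm, Matrix.toBilin'_apply', scalar_eq_dotProduct]

/-- The map `X ↦ R(X, Y) Z` as a linear map. -/
noncomputable def jacobiMap (γ : Fin m → Fin m → Coord m → ℝ) (x : Coord m) (Y Z : Fin m → ℝ) :
    (Fin m → ℝ) →ₗ[ℝ] (Fin m → ℝ) :=
  Matrix.toLin' (Matrix.of fun α κ => ∑ β, ∑ ν, curvatureCoeff γ α β κ ν x * Y ν * Z β)

theorem jacobiMap_apply (X Y Z : Fin m → ℝ) : jacobiMap γ x Y Z X = curvature γ x X Y Z := by
  ext α
  simp only [jacobiMap, Matrix.toLin'_apply, Matrix.mulVec, dotProduct, Matrix.of_apply,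
    curvature, Finset.sum_mul]
  rw [Finset.sum_comm]
  exact Finset.sum_congr rfl fun β _ => Finset.sum_congr rfl fun κ _ =>
    Finset.sum_congr rfl fun ν _ => by ring

theorem curvatureCoeff_swap (α β κ ν : Fin m) :
    curvatureCoeff γ α β κ ν x = -curvatureCoeff γ α β ν κ x := by
  simp only [curvatureCoeff, Finset.sum_sub_distrib]
  ring

theorem curvature_self (X Z : Fin m → ℝ) : curvature γ x X X Z = 0 := by
  ext α
  have h : curvature γ x X X Z α = -curvature γ x X X Z α := by
    simp only [curvature, ← Finset.sum_neg_distrib]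
    refine Finset.sum_congr rfl fun β _ => ?_
    rw [Finset.sum_comm]
    refine Finset.sum_congr rfl fun κ _ => Finset.sum_congr rfl fun ν _ => ?_
    rw [curvatureCoeff_swap]
    ring
  simpa using self_eq_neg.1 h

theorem curvature_eq_mulVec (X Y Z : Fin m → ℝ) : curvature γ x X Y Z =
    ∑ κ, ∑ ν, (X κ * Y ν) • (Matrix.of fun α β => curvatureCoeff γ α β κ ν x).mulVec Z := by
  ext α
  simp only [curvature, Finset.sum_apply, Pi.smul_apply, Matrix.mulVec, dotProduct,
    Matrix.of_apply, smul_eq_mul, Finset.mul_sum]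
  rw [Finset.sum_comm]
  refine Finset.sum_congr rfl fun κ _ => ?_
  rw [Finset.sum_comm]
  exact Finset.sum_congr rfl fun ν _ => Finset.sum_congr rfl fun β _ => by ring

namespace IsRiemMetric

variable (hγ : IsRiemMetric T γ)
include hγ

/-- The endomorphism `R(X, Y)` is skew-adjoint. -/
theorem scalar_curvature_skew (hx : x ∈ T) (X Y Z W : Fin m → ℝ) :
    scalar γ x (curvature γ x X Y Z) W = -scalar γ x (curvature γ x X Y W) Z := by
  simp only [← scalarForm_apply, curvature_eq_mulVec, map_sum, map_smul, LinearMap.sum_apply,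
    LinearMap.smul_apply, ← Finset.sum_neg_distrib, smul_eq_mul]
  refine Finset.sum_congr rfl fun κ _ => Finset.sum_congr rfl fun ν _ => ?_
  have h := hγ.gram_mul_curvatureCoeff_skew hx κ ν
  set R : Matrix (Fin m) (Fin m) ℝ := Matrix.of fun α β => curvatureCoeff γ α β κ ν x
  have key : ∀ Z W, scalarForm γ x (R.mulVec Z) W = W ⬝ᵥ (gram γ x * R).mulVec Z := fun Z W => by
    rw [scalarForm_apply, hγ.scalar_comm, scalar_eq_dotProduct, Matrix.mulVec_mulVec]
  have h1 : W ⬝ᵥ (gram γ x * R).mulVec Z = -(Z ⬝ᵥ (gram γ x * R).mulVec W) := by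
    conv_lhs => rw [eq_neg_of_add_eq_zero_left h]
    rw [Matrix.neg_mulVec, dotProduct_neg, Matrix.mulVec_transpose, dotProduct_comm,
      ← Matrix.dotProduct_mulVec]
  rw [key, key, h1, mul_neg]

theorem scalar_self_nonneg (hx : x ∈ T) (X : Fin m → ℝ) : 0 ≤ scalar γ x X X := by
  rw [scalar_eq_dotProduct]
  simpa [gram] using (hγ.posDef x hx).posSemidef.dotProduct_mulVec_nonneg X

theorem scalar_self_pos (hx : x ∈ T) {X : Fin m → ℝ} (hX : X ≠ 0) : 0 < scalar γ x X X := by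
  rw [scalar_eq_dotProduct]
  simpa [gram] using (hγ.posDef x hx).dotProduct_mulVec_pos hX

/-- The strict Cauchy–Schwarz inequality. -/
theorem gram_det_pos (hx : x ∈ T) {X Y : Fin m → ℝ} (h : LinearIndependent ℝ ![X, Y]) :
    0 < scalar γ x X X * scalar γ x Y Y - scalar γ x X Y ^ 2 := by
  have hY : Y ≠ 0 := h.ne_zero 1
  have hYY := hγ.scalar_self_pos hx hY
  -- the component of `X` orthogonal to `Y`, scaled by `⟨Y, Y⟩`
  have hne : scalar γ x Y Y • X - scalar γ x X Y • Y ≠ 0 := fun h0 => by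
    have := LinearIndependent.pair_iff.1 h (scalar γ x Y Y) (-scalar γ x X Y)
      (by rw [neg_smul, ← sub_eq_add_neg, h0])
    exact hYY.ne' this.1
  have hpos := hγ.scalar_self_pos hx hne
  have hcomm := hγ.scalar_comm (x := x) Y X
  simp only [← scalarForm_apply, map_sub, map_smul, LinearMap.sub_apply, LinearMap.smul_apply,
    smul_eq_mul] at hpos hYY hcomm ⊢
  rw [hcomm] at hpos
  refine pos_of_mul_pos_right (a := scalarForm γ x Y Y) ?_ hYY.le
  nlinarith [hpos]

/-- In negative curvature the quadratic form `X ↦ ⟨R(X, Y) Y, X⟩` is nonpositive, and it vanishes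
only on the multiples of `Y`. -/
theorem scalar_curvature_neg (hx : x ∈ T)
    (hK : ∀ X Y : Fin m → ℝ, LinearIndependent ℝ ![X, Y] → sectional γ x X Y < 0)
    {X Y : Fin m → ℝ} (hY : Y ≠ 0) :
    scalar γ x (curvature γ x X Y Y) X ≤ 0 ∧
      (scalar γ x (curvature γ x X Y Y) X = 0 → X ∈ Submodule.span ℝ {Y}) := by
  by_cases hXY : X ∈ Submodule.span ℝ {Y}
  · refine ⟨?_, fun _ => hXY⟩
    obtain ⟨c, rfl⟩ := Submodule.mem_span_singleton.1 hXY
    rw [← jacobiMap_apply, map_smul, jacobiMap_apply, curvature_self, ← scalarForm_apply]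
    simp
  · have hind : LinearIndependent ℝ ![X, Y] := by
      rw [LinearIndependent.pair_symm_iff, LinearIndependent.pair_iff' hY]
      exact fun c hc => hXY (Submodule.mem_span_singleton.2 ⟨c, hc⟩)
    have h1 := hK X Y hind
    rw [sectional, div_lt_iff₀ (hγ.gram_det_pos hx hind), zero_mul] at h1
    exact ⟨h1.le, fun h0 => absurd h0 h1.ne⟩

end IsRiemMetric
end Curvature

/-! ### The pullback connection and the Bochner argument -/

section Bochner

variable {n m : ℕ} {s D : Set (Coord n)} {T : Set (Coord m)} {L : Coord n → Coord n → ℝ}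
  {γ : Fin m → Fin m → Coord m → ℝ} {f : Coord n → Coord m} {x y : Coord n}

/-- `f : D → T` is a smooth map from a Finslerian domain to a Riemannian one. -/
structure IsLocalMap (s D : Set (Coord n)) (T : Set (Coord m)) (L : Coord n → Coord n → ℝ)
    (γ : Fin m → Fin m → Coord m → ℝ) (f : Coord n → Coord m) : Prop where
  finsler : IsFinslerSq s D L
  riem : IsRiemMetric T γ
  contDiffOn : ContDiffOn ℝ ∞ f D
  mapsTo : Set.MapsTo f D T

theorem stdVec_sum (v : Coord m) : v = ∑ κ, v κ • (stdVec κ : Coord m) := by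
  ext j
  simp [stdVec, Pi.single_apply]

namespace IsLocalMap

variable (hf : IsLocalMap s D T L γ f)
include hf

theorem smoothOn_comp {h : Coord m → ℝ} (hh : ContDiffOn ℝ ∞ h T) :
    SmoothOn D fun x _ => h (f x) :=
  SmoothOn.comp_fst (hh.comp hf.contDiffOn hf.mapsTo)

theorem smoothOn_dMap (i : Fin n) (α : Fin m) : SmoothOn D (dMap s f i α) :=
  (hf.smoothOn_comp (h := fun z => z α) (by fun_prop)).partialX hf.finsler.isRelOpen i

theorem dMap_eq (hx : x ∈ D) (i : Fin n) (α : Fin m) :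
    dMap s f i α x y = fderivWithin ℝ f s x (stdVec i) α := by
  have hfx : DifferentiableWithinAt ℝ f s x :=
    ((hf.contDiffOn.differentiableOn (by simp)) x hx).mono_of_mem_nhdsWithin
      (hf.finsler.isRelOpen.mem_nhdsWithin x hx)
  have h1 := ((EuclideanSpace.proj (𝕜 := ℝ) α : Coord m →L[ℝ] ℝ).hasFDerivAt.comp_hasFDerivWithinAt
    x hfx.hasFDerivWithinAt).fderivWithin
      (hf.finsler.isRelOpen.uniqueDiffOn x (hf.finsler.isRelOpen.subset hx))
  exact congrArg (fun A : Coord n →L[ℝ] ℝ => A (stdVec i)) h1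

theorem smoothOn_covDeriv {Z : Fin m → Coord n → Coord n → ℝ} (hZ : ∀ α, SmoothOn D (Z α))
    (i : Fin n) (α : Fin m) : SmoothOn D (covDeriv s L γ f i Z α) :=
  (hf.finsler.smoothOn_delta (hZ α) i).add (SmoothOn.sum fun β => SmoothOn.sum fun κ =>
    ((hf.smoothOn_comp (hf.riem.contDiffOn_christoffel α β κ)).mul
      (hf.smoothOn_dMap i β)).mul (hZ κ))

theorem smoothOn_tension (α : Fin m) : SmoothOn D (tension s L γ f α) :=
  SmoothOn.sum fun i => SmoothOn.sum fun j => (hf.finsler.smoothOn_metricInv i j).mul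
    (((hf.smoothOn_covDeriv (hf.smoothOn_dMap j) i α).sub
      (SmoothOn.sum fun k => (hf.finsler.smoothOn_chern k j i).mul (hf.smoothOn_dMap k α))).sub
        ((hf.finsler.smoothOn_oneFormP i).mul (hf.smoothOn_dMap j α)))

theorem delta_comp {h : Coord m → ℝ} (hh : ContDiffOn ℝ ∞ h T) (hx : x ∈ D) (i : Fin n) :
    delta s L i (fun x _ => h (f x)) x y =
      ∑ κ, dMap s f i κ x y * partialD κ h (f x) := by
  have hfx : DifferentiableWithinAt ℝ f s x :=
    ((hf.contDiffOn.differentiableOn (by simp)) x hx).mono_of_mem_nhdsWithin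
      (hf.finsler.isRelOpen.mem_nhdsWithin x hx)
  have hhx : DifferentiableAt ℝ h (f x) := (hh.contDiffAt
    (hf.riem.isOpen.mem_nhds (hf.mapsTo hx))).differentiableAt (by simp)
  have h1 := (hhx.hasFDerivAt.comp_hasFDerivWithinAt x hfx.hasFDerivWithinAt).fderivWithin
      (hf.finsler.isRelOpen.uniqueDiffOn x (hf.finsler.isRelOpen.subset hx))
  have h2 : partialX s i (fun x _ => h (f x)) x y =
      fderiv ℝ h (f x) (fderivWithin ℝ f s x (stdVec i)) :=
    congrArg (fun A : Coord n →L[ℝ] ℝ => A (stdVec i)) h1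
  rw [delta, h2, stdVec_sum (fderivWithin ℝ f s x (stdVec i)), map_sum]
  simp [partialY, partialD, hf.dMap_eq hx]

/-- The pullback connection is metric: `δᵢ⟨Z, W⟩ = ⟨DᵢZ, W⟩ + ⟨Z, DᵢW⟩`. -/
theorem delta_scalar {Z W : Fin m → Coord n → Coord n → ℝ} (hZ : ∀ α, SmoothOn D (Z α))
    (hW : ∀ α, SmoothOn D (W α)) (hx : x ∈ D) (hy : y ≠ 0) (i : Fin n) :
    delta s L i (fun x y => scalar γ (f x) (fun α => Z α x y) (fun α => W α x y)) x y =
      scalar γ (f x) (fun α => covDeriv s L γ f i Z α x y) (fun α => W α x y) +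
      scalar γ (f x) (fun α => Z α x y) (fun α => covDeriv s L γ f i W α x y) := by
  -- the connection matrix `A` of `Dᵢ = δᵢ + A`, for which `δᵢ G = G A + Aᵀ G`
  set A : Matrix (Fin m) (Fin m) ℝ := ∑ κ, dMap s f i κ x y • connMat γ κ (f x) with hA
  have hcov : ∀ Z : Fin m → Coord n → Coord n → ℝ, (fun α => covDeriv s L γ f i Z α x y) =
      (fun α => delta s L i (Z α) x y) + A.mulVec (fun α => Z α x y) := fun Z => by
    ext α
    simp only [covDeriv, Pi.add_apply, hA, Matrix.sum_mulVec, Matrix.smul_mulVec,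
      Finset.sum_apply, Pi.smul_apply, Matrix.mulVec, dotProduct, connMat, Matrix.of_apply,
      smul_eq_mul, Finset.mul_sum]
    congr 1
    exact Finset.sum_congr rfl fun β _ => Finset.sum_congr rfl fun κ _ => by ring
  have hG : (Matrix.of fun α β => delta s L i (fun x _ => γ α β (f x)) x y) =
      gram γ (f x) * A + A.transpose * gram γ (f x) := by
    have h1 : (Matrix.of fun α β => delta s L i (fun x _ => γ α β (f x)) x y) =
        ∑ κ, dMap s f i κ x y • derivMat κ (gram γ) (f x) := by
      ext α β
      rw [Matrix.of_apply, hf.delta_comp (hf.riem.contDiffOn α β) hx]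
      simp [Matrix.sum_apply, derivMat, gram]
    rw [h1, hA, Matrix.transpose_sum, Finset.mul_sum, Finset.sum_mul, ← Finset.sum_add_distrib]
    refine Finset.sum_congr rfl fun κ _ => ?_
    rw [hf.riem.derivMat_gram (hf.mapsTo hx), Matrix.transpose_smul, smul_add, Matrix.mul_smul,
      Matrix.smul_mul]
  have hγ : ∀ α β, SmoothOn D fun x _ => γ α β (f x) := fun α β =>
    hf.smoothOn_comp (hf.riem.contDiffOn α β)
  have hexp : delta s L i (fun x y => scalar γ (f x) (fun α => Z α x y) (fun α => W α x y)) x y =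
      (fun α => Z α x y) ⬝ᵥ (Matrix.of fun α β =>
          delta s L i (fun x _ => γ α β (f x)) x y).mulVec (fun α => W α x y) +
        scalar γ (f x) (fun α => delta s L i (Z α) x y) (fun α => W α x y) +
        scalar γ (f x) (fun α => Z α x y) (fun α => delta s L i (W α) x y) := by
    have hs : ∀ α β, SmoothOn D fun x y => γ α β (f x) * Z α x y * W β x y := fun α β =>
      ((hγ α β).mul (hZ α)).mul (hW β)
    simp only [scalar]
    rw [hf.finsler.delta_sum (fun α => SmoothOn.sum fun β => hs α β) hx hy]
    simp only [dotProduct, Matrix.mulVec, Matrix.of_apply, Finset.mul_sum,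
      ← Finset.sum_add_distrib]
    refine Finset.sum_congr rfl fun α _ => ?_
    rw [hf.finsler.delta_sum (fun β => hs α β) hx hy]
    refine Finset.sum_congr rfl fun β _ => ?_
    rw [hf.finsler.delta_mul ((hγ α β).mul (hZ α)) (hW β) hx hy,
      hf.finsler.delta_mul (hγ α β) (hZ α) hx hy]
    ring
  rw [hexp, hG, hcov, hcov]
  simp only [scalar_eq_dotProduct, Matrix.add_mulVec, Matrix.mulVec_add, dotProduct_add,
    add_dotProduct, ← Matrix.mulVec_mulVec]
  have h3 : A.mulVec (fun α => Z α x y) ⬝ᵥ (gram γ (f x)).mulVec (fun α => W α x y) =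
      (fun α => Z α x y) ⬝ᵥ A.transpose.mulVec ((gram γ (f x)).mulVec (fun α => W α x y)) := by
    rw [Matrix.dotProduct_mulVec (fun α => Z α x y), Matrix.vecMul_transpose]
  rw [h3]
  ring

/-- If `⟨Z, Z⟩` is constant then `⟨DⱼZ, Z⟩ = 0`. -/
theorem scalar_covDeriv_self {Z : Fin m → Coord n → Coord n → ℝ} (hZ : ∀ α, SmoothOn D (Z α))
    {c : ℝ} (hc : ∀ x ∈ D, ∀ y ≠ 0, scalar γ (f x) (fun α => Z α x y) (fun α => Z α x y) = c)
    (hx : x ∈ D) (hy : y ≠ 0) (j : Fin n) :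
    scalar γ (f x) (fun α => covDeriv s L γ f j Z α x y) (fun α => Z α x y) = 0 := by
  have h1 := hf.delta_scalar hZ hZ hx hy j
  have hs : SmoothOn D fun x y => scalar γ (f x) (fun α => Z α x y) (fun α => Z α x y) :=
    (SmoothOn.const c).congr fun p hp => hc _ hp.1 _ hp.2
  rw [hf.finsler.delta_congr hs (SmoothOn.const c) hc hx hy, IsFinslerSq.delta_const,
    hf.riem.scalar_comm (fun α => Z α x y)] at h1
  linarith

/-- If `⟨Z, Z⟩` is constant then `⟨DᵢDⱼZ, Z⟩ = -⟨DᵢZ, DⱼZ⟩`. -/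
theorem scalar_covDeriv_covDeriv {Z : Fin m → Coord n → Coord n → ℝ}
    (hZ : ∀ α, SmoothOn D (Z α))
    {c : ℝ} (hc : ∀ x ∈ D, ∀ y ≠ 0, scalar γ (f x) (fun α => Z α x y) (fun α => Z α x y) = c)
    (hx : x ∈ D) (hy : y ≠ 0) (i j : Fin n) :
    scalar γ (f x) (fun α => covDeriv s L γ f i (covDeriv s L γ f j Z) α x y)
        (fun α => Z α x y) =
      -scalar γ (f x) (fun α => covDeriv s L γ f i Z α x y)
        (fun α => covDeriv s L γ f j Z α x y) := by
  have hDZ := hf.smoothOn_covDeriv hZ j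
  have h1 := hf.delta_scalar hDZ hZ hx hy i
  have h0 := fun x (hx : x ∈ D) y (hy : y ≠ 0) => hf.scalar_covDeriv_self hZ hc hx hy j
  have hs : SmoothOn D fun x y => scalar γ (f x) (fun α => covDeriv s L γ f j Z α x y)
      (fun α => Z α x y) := (SmoothOn.const 0).congr fun p hp => h0 _ hp.1 _ hp.2
  rw [hf.finsler.delta_congr hs (SmoothOn.const 0) h0 hx hy, IsFinslerSq.delta_const,
    hf.riem.scalar_comm (fun α => covDeriv s L γ f j Z α x y)] at h1
  linarith

/-- If `⟨Z, Z⟩` is constant then `⟨ΔZ, Z⟩ = g^{ij}⟨DᵢZ, DⱼZ⟩`. -/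
theorem scalar_roughLaplacian {Z : Fin m → Coord n → Coord n → ℝ}
    (hZ : ∀ α, SmoothOn D (Z α))
    {c : ℝ} (hc : ∀ x ∈ D, ∀ y ≠ 0, scalar γ (f x) (fun α => Z α x y) (fun α => Z α x y) = c)
    (hx : x ∈ D) (hy : y ≠ 0) :
    scalar γ (f x) (fun α => roughLaplacian s L γ f Z α x y) (fun α => Z α x y) =
      ∑ i, ∑ j, metricInv L i j x y * scalar γ (f x) (fun α => covDeriv s L γ f i Z α x y)
        (fun α => covDeriv s L γ f j Z α x y) := by
  -- the first-order terms `Γ^k_{ij} D_k Z` and `Pᵢ Dⱼ Z` are orthogonal to `Z`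
  have hlap : (fun α => roughLaplacian s L γ f Z α x y) = ∑ i, ∑ j, metricInv L i j x y •
      (-(fun α => covDeriv s L γ f i (covDeriv s L γ f j Z) α x y)
        + (∑ k, chern s L k j i x y • (fun α => covDeriv s L γ f k Z α x y))
        + oneFormP s L i x y • (fun α => covDeriv s L γ f j Z α x y)) := by
    ext α
    simp [roughLaplacian, Finset.sum_apply, mul_add]
  have h0 := fun j => hf.scalar_covDeriv_self hZ hc hx hy j
  have h1 := fun i j => hf.scalar_covDeriv_covDeriv hZ hc hx hy i j
  simp only [← scalarForm_apply] at h0 h1 ⊢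
  rw [hlap]
  simp only [map_sum, map_smul, map_add, map_neg, LinearMap.sum_apply, LinearMap.smul_apply,
    LinearMap.add_apply, LinearMap.neg_apply, h0, h1, smul_eq_mul]
  simp

/-- In negative curvature, the differential of a biharmonic map whose tension has constant nonzero
norm takes its values in the line spanned by the tension: in
`0 = ⟨τ₂, τ⟩ = -g^{ij}⟨Dᵢτ, Dⱼτ⟩ + g^{ij}⟨R(φᵢ, τ)τ, φⱼ⟩` both terms are nonpositive. -/
theorem dMap_mem_span_tension
    (hK : ∀ z ∈ T, ∀ X Y : Fin m → ℝ, LinearIndependent ℝ ![X, Y] → sectional γ z X Y < 0)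
    (hbi : ∀ x ∈ D, ∀ y ≠ 0, ∀ α, bitension s L γ f α x y = 0)
    {c : ℝ} (hc : ∀ x ∈ D, ∀ y ≠ 0, tensionNorm s L γ f x y = c) (hc0 : c ≠ 0)
    (hx : x ∈ D) (hy : y ≠ 0) (i : Fin n) :
    (fun α => dMap s f i α x y) ∈ Submodule.span ℝ {fun α => tension s L γ f α x y} := by
  have hfx := hf.mapsTo hx
  have hS : (Matrix.of fun i j => metricInv L i j x y).PosDef := (hf.finsler.posDef x hx y hy).inv
  have hnorm : ∀ x ∈ D, ∀ y ≠ 0, scalar γ (f x) (fun α => tension s L γ f α x y)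
      (fun α => tension s L γ f α x y) = c ^ 2 := fun x hx y hy => by
    rw [← hc x hx y hy, tensionNorm, Real.sq_sqrt (hf.riem.scalar_self_nonneg (hf.mapsTo hx) _)]
  have hlap := hf.scalar_roughLaplacian hf.smoothOn_tension hnorm hx hy
  have hτ : (fun α => tension s L γ f α x y) ≠ 0 := fun h0 => by
    have := hnorm x hx y hy
    rw [h0, ← scalarForm_apply, map_zero] at this
    exact hc0 (by simpa using this.symm)
  set τ : Fin m → ℝ := fun α => tension s L γ f α x y
  set φ : Fin n → Fin m → ℝ := fun i α => dMap s f i α x y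
  -- the quadratic form `X ↦ ⟨R(X, τ) τ, X⟩`
  set B : (Fin m → ℝ) →ₗ[ℝ] (Fin m → ℝ) →ₗ[ℝ] ℝ :=
    (scalarForm γ (f x)).comp (jacobiMap γ (f x) τ τ)
  have hB : ∀ X Y, B X Y = scalar γ (f x) (curvature γ (f x) X τ τ) Y := fun X Y => by
    rw [← jacobiMap_apply, ← scalarForm_apply]; rfl
  have hneg := fun X : Fin m → ℝ => hf.riem.scalar_curvature_neg hfx (hK _ hfx) (X := X) hτ
  refine mem_of_sum_mul_bilin_nonneg hS φ B (fun X => by rw [hB]; exact (hneg X).1) _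
    (fun X hX => (hneg X).2 (by rw [← hB, hX])) ?_ i
  have hpos : 0 ≤ scalar γ (f x) (fun α => roughLaplacian s L γ f (tension s L γ f) α x y) τ := by
    have h1 := sum_mul_bilin_nonpos hS
      (fun i α => covDeriv s L γ f i (tension s L γ f) α x y) (-scalarForm γ (f x)) fun X => by
        rw [LinearMap.neg_apply, LinearMap.neg_apply, scalarForm_apply]
        linarith [hf.riem.scalar_self_nonneg hfx X]
    rw [hlap]
    simpa [scalarForm_apply] using h1
  have hbi' : (fun α => bitension s L γ f α x y) =
      -(fun α => roughLaplacian s L γ f (tension s L γ f) α x y)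
        - ∑ i, ∑ j, metricInv L i j x y • curvature γ (f x) (φ i) τ (φ j) := by
    ext α
    simp [bitension, Finset.sum_apply, τ, φ]
  have h2 : scalar γ (f x) (fun α => bitension s L γ f α x y) τ = 0 := by
    have : (fun α => bitension s L γ f α x y) = 0 := funext fun α => hbi x hx y hy α
    rw [this, ← scalarForm_apply]
    simp
  rw [hbi', ← scalarForm_apply] at h2
  simp only [map_sub, map_neg, map_sum, map_smul, LinearMap.sub_apply, LinearMap.neg_apply,
    LinearMap.sum_apply, LinearMap.smul_apply, smul_eq_mul, scalarForm_apply,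
    hf.riem.scalar_curvature_skew hfx _ τ _ τ, mul_neg, Finset.sum_neg_distrib] at h2
  simp only [Matrix.of_apply, hB]
  linarith

end IsLocalMap
end Bochner
/-! ### Hessians along lines -/

section Hessian

variable {E : Type*} [NormedAddCommGroup E] [NormedSpace ℝ E] {h : E → ℝ} {y : E}

/-- The second derivative along a line is the Hessian evaluated on its direction. -/
theorem iteratedDeriv_two_comp_line (hh : ContDiffAt ℝ 2 h y) (w : E) :
    iteratedDeriv 2 (fun t : ℝ => h (y + t • w)) 0 = fderiv ℝ (fderiv ℝ h) y w w := by
  have hline : ∀ t : ℝ, HasDerivAt (fun t : ℝ => y + t • w) w t := fun t => by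
    simpa using ((hasDerivAt_id t).smul_const w).const_add y
  have hev : ∀ᶠ t in 𝓝 (0 : ℝ), DifferentiableAt ℝ h (y + t • w) := by
    have h1 : ∀ᶠ z in 𝓝 y, ContDiffAt ℝ 2 h z := hh.eventually (by simp)
    have h2 : Filter.Tendsto (fun t : ℝ => y + t • w) (𝓝 0) (𝓝 y) := by
      simpa using (hline 0).continuousAt.tendsto
    filter_upwards [h2.eventually h1] with t ht using ht.differentiableAt (by norm_num)
  have h1 : deriv (fun t : ℝ => h (y + t • w)) =ᶠ[𝓝 0] fun t => fderiv ℝ h (y + t • w) w := by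
    filter_upwards [hev] with t ht
    exact (ht.hasFDerivAt.comp_hasDerivAt t (hline t)).deriv
  have h2 : HasFDerivAt (fderiv ℝ h) (fderiv ℝ (fderiv ℝ h) y) (y + (0 : ℝ) • w) := by
    simpa using ((hh.fderiv_right (m := 1) (by norm_num)).differentiableAt
      (by norm_num)).hasFDerivAt
  have h3 : HasDerivAt (fun t : ℝ => fderiv ℝ h (y + t • w))
      (fderiv ℝ (fderiv ℝ h) y w) 0 := h2.comp_hasDerivAt (0 : ℝ) (hline 0)
  have h4 := (ContinuousLinearMap.apply ℝ ℝ w).hasFDerivAt.comp_hasDerivAt (0 : ℝ) h3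
  rw [iteratedDeriv_succ, iteratedDeriv_one, h1.deriv_eq]
  exact h4.deriv

end Hessian

/-! ### Differentials as maps into the tangent bundle -/

section Coordinates

variable {E : Type*} [NormedAddCommGroup E] [NormedSpace ℝ E]
  {E' : Type*} [NormedAddCommGroup E'] [NormedSpace ℝ E']
  {H : Type*} [TopologicalSpace H] {I : ModelWithCorners ℝ E' H}
  {M : Type*} [TopologicalSpace M] [ChartedSpace H M] [IsManifold I ∞ M]

/-- The differential of a map defined on part of a vector space is smooth as a map into the
tangent bundle. -/
theorem contMDiffOn_mfderivWithin_vectorSpace {f : E → M} {U : Set E}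
    (hf : ContMDiffOn 𝓘(ℝ, E) I ∞ f U) (hU : UniqueDiffOn ℝ U) :
    ContMDiffOn 𝓘(ℝ, E × E) I.tangent ∞
      (fun p : E × E => (⟨f p.1, mfderivWithin 𝓘(ℝ, E) I f U p.1 p.2⟩ : TangentBundle I M))
      (U ×ˢ Set.univ) := by
  have : IsManifold I 1 M := IsManifold.of_le (n := ∞) (by simp)
  have h1 := hf.contMDiffOn_tangentMapWithin (m := ∞) (by simp) hU.uniqueMDiffOn
  have h2 : ContMDiff 𝓘(ℝ, E × E) 𝓘(ℝ, E).tangent ∞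
      (fun p : E × E => (⟨p.1, p.2⟩ : TangentBundle 𝓘(ℝ, E) E)) := fun p => by
    rw [Bundle.contMDiffAt_totalSpace]
    refine ⟨contDiff_fst.contMDiff.contMDiffAt, ?_⟩
    have h3 : ContMDiffAt 𝓘(ℝ, E × E) 𝓘(ℝ, E) ∞ (Prod.snd : E × E → E) p :=
      contDiff_snd.contMDiff.contMDiffAt
    convert! h3 with q
    simp
    rfl
  exact h1.comp h2.contMDiffOn fun p hp => hp.1

end Coordinates

/-! ### The Riemannian metric in a chart -/

section Riem

variable {m : ℕ} {N : Type*} [TopologicalSpace N] [ChartedSpace (Coord m) N]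
  [IsManifold (𝓡 m) ∞ N]

theorem isRiemMetric_riemCoord (g : RiemannianMetricOn m N)
    {e : OpenPartialHomeomorph N (Coord m)} (he : e ∈ IsManifold.maximalAtlas (𝓡 m) ∞ N) :
    IsRiemMetric e.target (riemCoord g e) where
  isOpen := e.open_target
  contDiffOn α β := by
    have hU : UniqueDiffOn ℝ e.target := e.open_target.uniqueDiffOn
    have hsymm := contMDiffOn_symm_of_mem_maximalAtlas he
    have hv : ∀ v : Coord m, ContMDiffOn (𝓡 m) (𝓡 m).tangent ∞
        (fun x => (⟨e.symm x, mfderiv (𝓡 m) (𝓡 m) e.symm x v⟩ : TangentBundle (𝓡 m) N))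
        e.target := fun v => by
      have h1 : ContMDiffOn (𝓡 m) 𝓘(ℝ, Coord m × Coord m) ∞ (fun x : Coord m => (x, v))
          e.target := (contDiff_prodMk_left v).contMDiff.contMDiffOn
      refine ((contMDiffOn_mfderivWithin_vectorSpace hsymm hU).comp h1
        fun x hx => ⟨hx, Set.mem_univ _⟩).congr fun x hx => ?_
      simp only [Function.comp]
      rw [mfderivWithin_of_isOpen e.open_target hx]
    have h2 : ContMDiffOn (𝓡 m) ((𝓡 m).prod 𝓘(ℝ)) ∞
        (fun x => Bundle.TotalSpace.mk' ℝ (E := Bundle.Trivial N ℝ) (e.symm x)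
          (riemCoord g e α β x)) e.target := by
      apply ContMDiffOn.clm_bundle_apply₂ (F₁ := Coord m) (F₂ := Coord m)
      · exact g.contMDiff.comp_contMDiffOn hsymm
      · exact hv _
      · exact hv _
    intro x hx
    have h3 := h2 x hx
    rw [Bundle.contMDiffWithinAt_totalSpace] at h3
    exact h3.2.contDiffWithinAt
  symm α β := by
    ext x
    exact g.symm _ _ _
  posDef x hx := by
    have hmd : e.MDifferentiable (𝓡 m) (𝓡 m) :=
      ⟨(contMDiffOn_of_mem_maximalAtlas he).mdifferentiableOn (by simp),
        (contMDiffOn_symm_of_mem_maximalAtlas he).mdifferentiableOn (by simp)⟩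
    refine .of_dotProduct_mulVec_pos ?_ fun w hw => ?_
    · ext α β
      exact g.symm _ _ _
    · set A := mfderiv (𝓡 m) (𝓡 m) e.symm x
      have hinj : Function.Injective A := hmd.symm.mfderiv_injective hx
      set v : Coord m := ∑ α, w α • stdVec α with hv
      have hv0 : v ≠ 0 := fun h0 => hw <| by
        ext α
        have := congrArg (fun u : Coord m => u α) h0
        simpa [hv, stdVec, Pi.single_apply] using this
      have h0 : A v ≠ 0 := fun h => hv0 (hinj (h.trans (map_zero A).symm))
      have hpos := g.pos (e.symm x) (A v) h0
      have h1 : g.inner (e.symm x) (A v) (A v) =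
          ∑ α, ∑ β, w α * w β * riemCoord g e α β x := by
        have hA : A v = ∑ α, w α • A (stdVec α) := by
          rw [hv]
          exact (map_sum A _ _).trans (Finset.sum_congr rfl fun α _ => map_smul A _ _)
        rw [hA]
        simp only [map_sum, map_smul, sum_apply, smul_apply, smul_eq_mul, Finset.mul_sum]
        exact Finset.sum_congr rfl fun α _ => Finset.sum_congr rfl fun β _ => by
          rw [riemCoord, g.symm, mul_assoc]
      rw [h1] at hpos
      refine hpos.trans_eq ?_
      simp only [dotProduct, Matrix.mulVec, Finset.mul_sum, Matrix.of_apply, star_trivial]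
      exact Finset.sum_congr rfl fun α _ => Finset.sum_congr rfl fun β _ => by ring

end Riem

theorem IsRelOpen.mono {n : ℕ} {s D D' : Set (Coord n)} (hD : IsRelOpen s D) (hD' : D' ⊆ D)
    (h : ∀ x ∈ D', D' ∈ 𝓝[D] x) : IsRelOpen s D' where
  uniqueDiffOn := hD.uniqueDiffOn
  subset := hD'.trans hD.subset
  mem_nhdsWithin x hx := by
    rw [← hD.nhdsWithin_eq (hD' hx)]
    exact h x hx

/-! ### Charts of manifolds with boundary -/

section Charts

variable {n : ℕ} {H : Type*} [TopologicalSpace H] {I : ModelWithCorners ℝ (Coord n) H}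
  {M : Type*} [TopologicalSpace M]

theorem isRelOpen_extend_target (e : OpenPartialHomeomorph M H) :
    IsRelOpen (Set.range I) (e.extend I).target where
  uniqueDiffOn := I.uniqueDiffOn
  subset := e.extend_target_subset_range
  mem_nhdsWithin x hx := by
    have h := e.extend_target_mem_nhdsWithin (I := I) (y := (e.extend I).symm x)
      (by simpa using (e.extend I).map_target hx)
    rwa [(e.extend I).right_inv hx] at h

theorem contMDiffOn_extend_symm_target [ChartedSpace H M]
    {e : OpenPartialHomeomorph M H} (he : e ∈ IsManifold.maximalAtlas I ∞ M) :
    ContMDiffOn 𝓘(ℝ, Coord n) I ∞ (e.extend I).symm (e.extend I).target := by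
  rw [e.extend_target']
  exact contMDiffOn_extend_symm he

/-- The differential of the chart is a left inverse. -/
theorem mfderivWithin_extend_symm_injective [ChartedSpace H M]
    {e : OpenPartialHomeomorph M H} (he : e ∈ IsManifold.maximalAtlas I ∞ M)
    {x : Coord n} (hx : x ∈ (e.extend I).target) : Function.Injective
      (mfderivWithin 𝓘(ℝ, Coord n) I (e.extend I).symm (Set.range I) x) := by
  have hD := isRelOpen_extend_target (I := I) e
  have h1 : MDifferentiableWithinAt 𝓘(ℝ, Coord n) I (e.extend I).symm (Set.range I) x :=
    ((contMDiffOn_extend_symm_target he x hx).mdifferentiableWithinAt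
      (by simp)).mono_of_mem_nhdsWithin (hD.mem_nhdsWithin x hx)
  have hx' : (e.extend I).symm x ∈ e.source := by simpa using (e.extend I).map_target hx
  have h2 : MDifferentiableAt I 𝓘(ℝ, Coord n) (e.extend I) ((e.extend I).symm x) :=
    (e.contMDiffAt_extend he hx').mdifferentiableAt (by simp)
  have h3 := h2.hasMFDerivAt.comp_hasMFDerivWithinAt x h1.hasMFDerivWithinAt
  have h4 : HasMFDerivWithinAt 𝓘(ℝ, Coord n) 𝓘(ℝ, Coord n) (e.extend I ∘ (e.extend I).symm)
      (Set.range I) x (ContinuousLinearMap.id ℝ _) := by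
    refine (hasMFDerivWithinAt_id (Set.range I) x).congr_of_eventuallyEq ?_
      ((e.extend I).right_inv hx)
    filter_upwards [hD.mem_nhdsWithin x hx] with z hz using (e.extend I).right_inv hz
  have h5 := (I.uniqueDiffOn x (hD.subset hx)).uniqueMDiffWithinAt.eq h3 h4
  exact Function.LeftInverse.injective fun v => DFunLike.congr_fun h5 v

end Charts

/-! ### The Finsler function in a chart -/

section Finsler

variable {n : ℕ} {H : Type*} [TopologicalSpace H] {I : ModelWithCorners ℝ (Coord n) H}
  {M : Type*} [TopologicalSpace M] [ChartedSpace H M] [IsManifold I ∞ M]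
  {e : OpenPartialHomeomorph M H}

theorem smoothOn_sqCoord (F : FinslerStructure I M) (he : e ∈ IsManifold.maximalAtlas I ∞ M) :
    SmoothOn (e.extend I).target (F.sqCoord e) := by
  have hD := isRelOpen_extend_target (I := I) e
  have h1 := contMDiffOn_mfderivWithin_vectorSpace (contMDiffOn_extend_symm_target he)
    hD.uniqueDiffOn_self
  have heq : ∀ x ∈ (e.extend I).target,
      mfderivWithin 𝓘(ℝ, Coord n) I (e.extend I).symm (e.extend I).target x =
      mfderivWithin 𝓘(ℝ, Coord n) I (e.extend I).symm (Set.range I) x := fun x hx =>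
    mfderivWithin_congr_set (nhdsWithin_eq_iff_eventuallyEq.1 (hD.nhdsWithin_eq hx))
  have h2 : ContMDiffOn 𝓘(ℝ, Coord n × Coord n) 𝓘(ℝ, ℝ) ∞ (fun p : Coord n × Coord n =>
      F.toFun ⟨(e.extend I).symm p.1,
        mfderivWithin 𝓘(ℝ, Coord n) I (e.extend I).symm (Set.range I) p.1 p.2⟩)
      (slit (e.extend I).target) := by
    refine (F.smooth_toFun.comp (h1.mono (Set.prod_mono subset_rfl (Set.subset_univ _)))
      fun p hp => ?_).congr fun p hp => ?_
    · change mfderivWithin 𝓘(ℝ, Coord n) I (e.extend I).symm (e.extend I).target p.1 p.2 ≠ 0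
      rw [heq _ hp.1]
      intro h0
      exact hp.2 (mfderivWithin_extend_symm_injective he hp.1 (h0.trans (map_zero _).symm))
    · simp only [Function.comp]
      rw [heq _ hp.1]
  exact h2.contDiffOn.pow 2

/-- The matrix of `½ ∂²F²/∂yᵏ∂yˡ` is that of the quadratic form `w ↦ ½ d²/dt² F²(v + t w)`, read
through the isomorphism of `ℝⁿ` with the tangent space. -/
theorem metric_sqCoord_posDef (F : FinslerStructure I M)
    (he : e ∈ IsManifold.maximalAtlas I ∞ M) {x y : Coord n} (hx : x ∈ (e.extend I).target)
    (hy : y ≠ 0) : (Matrix.of fun k l => metric (F.sqCoord e) k l x y).PosDef := by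
  have hsm : ContDiffAt ℝ ∞ (F.sqCoord e x) y :=
    ((smoothOn_sqCoord F he).comp (contDiff_prodMk_right x).contDiffOn
      (fun y hy => mk_mem_slit hx hy)).contDiffAt (isOpen_compl_singleton.mem_nhds hy)
  have hsm2 : ContDiffAt ℝ 2 (F.sqCoord e x) y := hsm.of_le ENat.LEInfty.out
  have hd : DifferentiableAt ℝ (fderiv ℝ (F.sqCoord e x)) y :=
    (hsm2.fderiv_right (m := 1) (by norm_num)).differentiableAt (by norm_num)
  set Q := fderiv ℝ (fderiv ℝ (F.sqCoord e x)) y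
  have hmetric : ∀ k l, metric (F.sqCoord e) k l x y = (1 / 2) * Q (stdVec k) (stdVec l) :=
    fun k l => by
      simp only [metric, partialY]
      rw [fderiv_clm_apply hd (differentiableAt_const _)]
      simp [Q]
  have hQ : ∀ v w, Q v w = Q w v := fun v w => hsm2.isSymmSndFDerivAt (by simp) _ _
  refine .of_dotProduct_mulVec_pos ?_ fun w hw => ?_
  · ext k l
    simp [hmetric, hQ (stdVec k)]
  · set A := mfderivWithin 𝓘(ℝ, Coord n) I (e.extend I).symm (Set.range I) x with hA
    have hinj : Function.Injective A := mfderivWithin_extend_symm_injective he hx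
    set v : Coord n := ∑ k, w k • stdVec k with hv
    have hv0 : v ≠ 0 := fun h0 => hw <| by
      ext k
      have := congrArg (fun u : Coord n => u k) h0
      simpa [hv, stdVec, Pi.single_apply] using this
    have hne : ∀ u : Coord n, u ≠ 0 → A u ≠ 0 := fun u hu h =>
      hu (hinj (h.trans (map_zero A).symm))
    have hpos := F.posDef ((e.extend I).symm x) (A y) (A v) (hne y hy) (hne v hv0)
    have hfun : (fun t : ℝ => F.toFun ⟨(e.extend I).symm x, A y + t • A v⟩ ^ 2) =
        fun t : ℝ => F.sqCoord e x (y + t • v) := by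
      funext t
      have : A (y + t • v) = A y + t • A v := 
        (map_add A _ _).trans (congrArg (A y + ·) (map_smul A t v))
      rw [FinslerStructure.sqCoord, ← hA, this]
    rw [hfun, iteratedDeriv_two_comp_line hsm2] at hpos
    change 0 < 1 / 2 * Q v v at hpos
    refine hpos.trans_eq ?_
    simp only [dotProduct, Matrix.mulVec, Finset.mul_sum, Matrix.of_apply, star_trivial,
      hmetric, hv, map_sum, map_smul, sum_apply, smul_apply, smul_eq_mul]
    exact Finset.sum_congr rfl fun k _ => Finset.sum_congr rfl fun l _ => by
      rw [hQ (stdVec l)]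
      ring

end Finsler
/-! ### Coordinate expressions of maps -/

section Global

variable {n m : ℕ} {H : Type*} [TopologicalSpace H] {I : ModelWithCorners ℝ (Coord n) H}
  {M : Type*} [TopologicalSpace M] [ChartedSpace H M] [IsManifold I ∞ M]
  {N : Type*} [TopologicalSpace N] [ChartedSpace (Coord m) N] [IsManifold (𝓡 m) ∞ N]
  {φ : M → N} {e : OpenPartialHomeomorph M H} {e' : OpenPartialHomeomorph N (Coord m)}

/-- The coordinate expression of a smooth map satisfies the hypotheses of the local analysis. -/
theorem isLocalMap_mapCoord (F : FinslerStructure I M) (g : RiemannianMetricOn m N)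
    (hφ : ContMDiff I (𝓡 m) ∞ φ) (he : e ∈ IsManifold.maximalAtlas I ∞ M)
    (he' : e' ∈ IsManifold.maximalAtlas (𝓡 m) ∞ N) :
    IsLocalMap (Set.range I) (mapDomain I φ e e') e'.target (F.sqCoord e) (riemCoord g e')
      (mapCoord I φ e e') where
  finsler :=
    { isRelOpen := (isRelOpen_extend_target e).mono (fun x hx => hx.1) fun x hx => by
        have h1 : ContinuousWithinAt (fun x => φ ((e.extend I).symm x)) (e.extend I).target x :=
          hφ.continuous.continuousAt.comp_continuousWithinAt
            ((contMDiffOn_extend_symm_target he).continuousOn x hx.1)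
        exact Filter.inter_mem self_mem_nhdsWithin
          (h1.preimage_mem_nhdsWithin (e'.open_source.mem_nhds hx.2))
      smoothOn := (smoothOn_sqCoord F he).mono (Set.prod_mono (fun x hx => hx.1) subset_rfl)
      posDef := fun x hx y hy => metric_sqCoord_posDef F he hx.1 hy }
  riem := isRiemMetric_riemCoord g he'
  contDiffOn := by
    have h1 : ContMDiffOn 𝓘(ℝ, Coord n) (𝓡 m) ∞ (mapCoord I φ e e') (mapDomain I φ e e') :=
      (contMDiffOn_of_mem_maximalAtlas he').comp
        (hφ.comp_contMDiffOn ((contMDiffOn_extend_symm_target he).mono fun x hx => hx.1))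
        fun x hx => hx.2
    exact h1.contDiffOn
  mapsTo x hx := e'.map_source hx.2

/-- A linear map whose values on the standard basis are multiples of one vector has rank at most
one. -/
theorem finrank_range_le_one {A : Coord n →L[ℝ] Coord m} {v : Fin m → ℝ}
    (hA : ∀ i : Fin n, (fun α => A (stdVec i) α) ∈ Submodule.span ℝ {v}) :
    Module.finrank ℝ (LinearMap.range A.toLinearMap) ≤ 1 := by
  have hle : LinearMap.range A.toLinearMap ≤ Submodule.span ℝ {(WithLp.toLp 2 v : Coord m)} := by
    rintro _ ⟨u, rfl⟩
    rw [stdVec_sum u, map_sum]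
    refine Submodule.sum_mem _ fun i _ => ?_
    rw [map_smul]
    refine Submodule.smul_mem _ _ ?_
    obtain ⟨c, hc⟩ := Submodule.mem_span_singleton.1 (hA i)
    refine Submodule.mem_span_singleton.2 ⟨c, ?_⟩
    ext α
    exact congrFun hc α
  exact (Submodule.finrank_mono hle).trans ((finrank_span_le_card _).trans (by simp))

theorem isHarmonic_of_tensionNorm_eq_zero (F : FinslerStructure I M) (g : RiemannianMetricOn m N)
    (h : ∀ e ∈ IsManifold.maximalAtlas I ∞ M, ∀ e' ∈ IsManifold.maximalAtlas (𝓡 m) ∞ N,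
      ∀ x ∈ mapDomain I φ e e', ∀ y : Coord n, y ≠ 0 →
        tensionNorm (Set.range I) (F.sqCoord e) (riemCoord g e') (mapCoord I φ e e') x y = 0) :
    IsHarmonic F g φ := by
  intro e he e' he' x hx y hy α
  by_contra hα
  have hne : (fun α => tension (Set.range I) (F.sqCoord e) (riemCoord g e')
      (mapCoord I φ e e') α x y) ≠ 0 := fun h0 => hα (congrFun h0 α)
  have hpos := (isRiemMetric_riemCoord g he').scalar_self_pos (e'.map_source hx.2) hne
  exact (Real.sqrt_pos.2 hpos).ne' (h e he e' he' x hx y hy)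

end Global

/-- In the preferred charts at `p` and `φ p`, the rank of `φ` is that of its coordinate
differential. -/
theorem rankAt_eq {n m : ℕ} {H : Type*} [TopologicalSpace H]
    {I : ModelWithCorners ℝ (Coord n) H} {M : Type*} [TopologicalSpace M] [ChartedSpace H M]
    {N : Type*} [TopologicalSpace N] [ChartedSpace (Coord m) N] {φ : M → N}
    (hφ : ContMDiff I (𝓡 m) ∞ φ) (p : M) :
    rankAt m I φ p = Module.finrank ℝ (LinearMap.range (fderivWithin ℝ
      (mapCoord I φ (chartAt H p) (chartAt (Coord m) (φ p))) (Set.range I)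
      (extChartAt I p p)).toLinearMap) := by
  have hd : MDifferentiableAt I (𝓡 m) φ p := hφ.mdifferentiableAt (by simp)
  rw [rankAt, hd.mfderiv]
  rfl

end FinslerRiemann

theorem mainTheorem2 {n m : ℕ}
    {H : Type*} [TopologicalSpace H] {I : ModelWithCorners ℝ (FinslerRiemann.Coord n) H}
    {M : Type*} [TopologicalSpace M] [ChartedSpace H M] [IsManifold I ∞ M]
    {N : Type*} [TopologicalSpace N] [ChartedSpace (FinslerRiemann.Coord m) N]
    [IsManifold (𝓡 m) ∞ N]
    (F : FinslerRiemann.FinslerStructure I M) (g : FinslerRiemann.RiemannianMetricOn m N)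
    (hg : FinslerRiemann.NegativeSectionalCurvature g)
    (φ : M → N) (hφ : ContMDiff I (𝓡 m) ∞ φ)
    (hbi : FinslerRiemann.IsBiharmonic F g φ)
    (hnorm : FinslerRiemann.HasConstantTensionNorm F g φ)
    (hrank : ∃ p : M, 2 ≤ FinslerRiemann.rankAt m I φ p) :
    FinslerRiemann.IsHarmonic F g φ := by
  open FinslerRiemann in
  obtain ⟨c, hc⟩ := hnorm
  obtain ⟨p, hp⟩ := hrank
  by_cases hc0 : c = 0
  · subst hc0
    exact isHarmonic_of_tensionNorm_eq_zero F g hc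
  exfalso
  have he := IsManifold.chart_mem_maximalAtlas (I := I) (n := ∞) p
  have he' := IsManifold.chart_mem_maximalAtlas (I := 𝓡 m) (n := ∞) (φ p)
  have hloc := isLocalMap_mapCoord F g hφ he he'
  have hx : extChartAt I p p ∈ mapDomain I φ (chartAt H p) (chartAt (Coord m) (φ p)) := by
    refine ⟨mem_extChartAt_target p, ?_⟩
    change φ ((extChartAt I p).symm (extChartAt I p p)) ∈ _
    rw [extChartAt_to_inv]
    exact mem_chart_source _ _
  -- a nonzero tangent vector exists, as the source of a map of rank two has positive dimension
  have hn : 0 < n := by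
    rw [rankAt_eq hφ p] at hp
    have h1 := hp.trans (LinearMap.finrank_range_le _)
    rw [finrank_euclideanSpace_fin] at h1
    lia
  have hy : (stdVec ⟨0, hn⟩ : Coord n) ≠ 0 := by simp [stdVec]
  have hspan := fun i => hloc.dMap_mem_span_tension (hg _ he') (hbi _ he _ he') (hc _ he _ he')
    hc0 hx hy i
  simp only [hloc.dMap_eq hx] at hspan
  have h1 := finrank_range_le_one hspan
  rw [← rankAt_eq hφ p] at h1
  lia
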